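/- Let $s\ge 1$ and $0\le K< M$ be integers, $N=M-K$, let $p_1,\dots,p_s\ge 0$ be prices, $\lambda_j=\sum_{k=j}^s p_k$, and let $\Phi$ be a real number (the budget). An \emph{allocation} is a sequence of nonnegative integers $C_1,\dots,C_s$ with $$C_1\le C_2\le\dots\le C_s,\quad C_1\ge K,\quad C_s\le M,\quad C_s-C_1=M-K,\qquad C_1\sum_{i=1}^s p_i\le\sum_{i=1}^s C_ip_i\le\Phi\le C_s\sum_{i=1}^s p_i .$$ All allocations are regarded as equiprobable. Let the real numbers $\beta,\sigma$ satisfy $\beta\lambda_j>\sigma$ $(2\le j\le s)$ and $$\sum_{j=2}^s\frac1{e^{\beta\lambda_j-\sigma}-1}=M-K,\qquad \sum_{i=2}^s p_i\sum_{j=2}^i\frac1{e^{\beta\lambda_j-\sigma}-1}=\Phi-K\sum_{i=1}^s p_i. \tag{$*$}$$ (a) If $s\ge2$ and $N\lambda_s<\Phi-K\sum_{i=1}^s p_i\le \frac{N}{s-1}\sum_{j=2}^s\lambda_j$, then there is exactly one pair $(\beta,\sigma)$ with these properties, and it has $\beta\ge0$. (b) Let $a_1,\delta>0$ and $a_2,B,\beta_0,R$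 be real constants. There is a constant $A>0$, depending only on $a_1,a_2,B,\beta_0,R,\delta$, such that for every $m\in\mathbb N$ and every $c>0$ there is $N_0$ such that the following holds for all data as above with $N\ge N_0$, $a_1N\le s\le a_2N$, $\lambda_i\le B$ $(1\le i\le s)$, $(*)$ and $0\le\beta\le\beta_0$, provided that either $e^{\beta_0B}<1+a_1$, or $\frac1{e^{\beta\lambda_j-\sigma}-1}\le R$ for all $2\le j\le s$. The number of allocations that violate $$\Bigl|\,C_i-C_1-\sum_{j=2}^i\frac1{e^{\beta\sum_{k=j}^sp_k-\sigma}-1}\Bigr|\le A\,N^{3/4}\qquad\text{for all } i \text{ with } \delta N<i\le s$$ is less than $cN^{-m}$ times the number of all allocations. In other words, the allocations $C_i=C_1+\sum_{j=2}^i\frac{1}{e^{\beta\sum_{k\ge j}p_k-\sigma}-1}+O(N^{3/4})$, $i>\delta N$, form the overwhelmingly largest ("risk-free") cluster. -/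

import Mathlib

open Finset

noncomputable section

/-- The tail sum `λ_j = p_j + p_{j+1} + ⋯ + p_s` of the prices. -/
def tailPrice (s : ℕ) (p : ℕ → ℝ) (j : ℕ) : ℝ :=
  ∑ k ∈ Icc j s, p k

/-- The mean increment `1 / (e^{β λ_j - σ} - 1)`. -/
def meanIncrement (s : ℕ) (p : ℕ → ℝ) (β σ : ℝ) (j : ℕ) : ℝ :=
  1 / (Real.exp (β * tailPrice s p j - σ) - 1)

/-- Admissible share allocations `C_1, …, C_s`. A finite sequence is encoded as a function on `ℕ`
that vanishes outside `{1, …, s}`, so that each allocation is counted once. -/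
structure IsAllocation (s K M : ℕ) (p : ℕ → ℝ) (Φ : ℝ) (C : ℕ → ℕ) : Prop where
  support : ∀ i, i ∉ Icc 1 s → C i = 0
  ordered : ∀ i ∈ Ico 1 s, C i ≤ C (i + 1)
  lower : K ≤ C 1
  upper : C s ≤ M
  /-- the increments `C_i - C_{i-1}`, `2 ≤ i ≤ s`, add up to `M - K` -/
  total : (C s : ℤ) - C 1 = M - K
  budget_lower : (C 1 : ℝ) * ∑ i ∈ Icc 1 s, p i ≤ ∑ i ∈ Icc 1 s, (C i : ℝ) * p i
  budget : ∑ i ∈ Icc 1 s, (C i : ℝ) * p i ≤ Φ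
  budget_upper : Φ ≤ (C s : ℝ) * ∑ i ∈ Icc 1 s, p i

/-- The set of all admissible allocations (the equiprobable outcomes). -/
def allocations (s K M : ℕ) (p : ℕ → ℝ) (Φ : ℝ) : Set (ℕ → ℕ) :=
  {C | IsAllocation s K M p Φ C}

/-- The two conditions that determine `β` and `σ`: the mean increments are (finite and) positive,
they add up to `M - K`, and they exhaust the budget. -/
structure IsParameters (s K M : ℕ) (p : ℕ → ℝ) (Φ β σ : ℝ) : Prop where
  pos : ∀ j ∈ Icc 2 s, 0 < β * tailPrice s p j - σ
  total : ∑ j ∈ Icc 2 s, meanIncrement s p β σ j = (M : ℝ) - K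
  budget : ∑ i ∈ Icc 2 s, p i * ∑ j ∈ Icc 2 i, meanIncrement s p β σ j
    = Φ - K * ∑ i ∈ Icc 1 s, p i

/-- The cluster of admissible allocations with
`|C_i - C_1 - ∑_{j=2}^i 1 / (e^{β λ_j - σ} - 1)| ≤ A N^{3/4}` for all `i > δ N`, `N = M - K`. -/
def cluster (s K M : ℕ) (p : ℕ → ℝ) (Φ β σ δ A : ℝ) : Set (ℕ → ℕ) :=
  {C | C ∈ allocations s K M p Φ ∧ ∀ i ∈ Icc 1 s, δ * ((M : ℝ) - K) < i →
    |(C i : ℝ) - ((C 1 : ℝ) + ∑ j ∈ Icc 2 i, meanIncrement s p β σ j)|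
      ≤ A * ((M : ℝ) - K) ^ (3 / 4 : ℝ)}

theorem IsAllocation.le_upper {s K M : ℕ} {p : ℕ → ℝ} {Φ : ℝ} {C : ℕ → ℕ}
    (h : IsAllocation s K M p Φ C) (i : ℕ) : C i ≤ M := by
  by_cases hi : i ∈ Icc 1 s
  · rw [mem_Icc] at hi
    have key : ∀ k, i ≤ k → k ≤ s → C i ≤ C k := by
      intro k hk
      induction k, hk using Nat.le_induction with
      | base => exact fun _ => le_rfl
      | succ k hk ih =>
        intro hs
        exact (ih (by omega)).trans (h.ordered k (by rw [mem_Ico]; omega))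
    exact (key s hi.2 le_rfl).trans h.upper
  · rw [h.support i hi]; exact Nat.zero_le _

/-- There are finitely many allocations, so counting them with `Set.ncard` is meaningful. -/
theorem allocations_finite (s K M : ℕ) (p : ℕ → ℝ) (Φ : ℝ) : (allocations s K M p Φ).Finite := by
  refine Set.Finite.of_injOn (f := fun (C : ℕ → ℕ) (i : Fin (s + 1)) => C i)
    (t := Set.Iic (fun _ => M)) ?_ ?_ (Set.finite_Iic _)
  · intro C hC i
    exact IsAllocation.le_upper hC i
  · intro C hC D hD h
    funext i
    by_cases hi : i ∈ Icc 1 s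
    · rw [mem_Icc] at hi
      exact congrFun h ⟨i, by omega⟩
    · rw [hC.support i hi, hD.support i hi]

end

/-!
By telescoping, allocations correspond to the distributions of `N = M - K` particles over levels of
energies `λ_2, …, λ_s` with total energy at most `E = Φ - K ∑ p_i`. Let the occupation numbers be
independent geometric variables of means `1 / (e^{β λ_j - σ} - 1)`. As `β ≥ 0`, every admissible
configuration has at least the probability `w` of one of energy exactly `E`, so by Chernoff bounds
at most `w⁻¹ s e^{-c √N}` configurations deviate by `A N^{3/4}`, where `c` grows with `A`.

Conversely there are at least `w⁻¹ e^{-O(√N)}` configurations. Keep about `√N` of the highest levels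
empty. A typical configuration on the other levels then misses particles and energy by an amount
of order `√N`, and putting the missing particles on the lowest level meets both constraints; this
changes the probability by a factor `e^{O(√N)}` only. For large `A` the deviating configurations
are therefore an exponentially small fraction.

Existence of `(β, σ)` comes from two nested intermediate-value arguments: for given `β` the number
of particles determines `σ`, and along the resulting curve the energy per particle passes from the
mean of the levels at `β = 0` to near the lowest level as `β → ∞`. For uniqueness, the constraints
force `∑ (x_j - y_j) (f(x_j) - f(y_j)) = 0` for the exponents `x_j`, `y_j` of two solutions and
the strictly decreasing function `f(x) = 1 / (e^x - 1)`.
-/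

noncomputable section GeometricLaw

open MeasureTheory ProbabilityTheory

/-- The mean `1 / (e^x - 1)` of a geometric variable of ratio `e^{-x}`; see `meanIncrement`. -/
def geomMean (x : ℝ) : ℝ := 1 / (Real.exp x - 1)

/-- The law `n ↦ (1 - e^{-x}) e^{-xn}` on `ℕ`. The success probability `1 - e^{-x}` is projected to
the unit interval, which changes it only for `x < 0`. -/
def geomLaw (x : ℝ) : Measure ℕ :=
  geometricMeasure (Set.projIcc 0 1 zero_le_one (1 - Real.exp (-x)))

/-- The variance proxy in the sub-Gaussian bound for geometric variables of mean at most `R`. -/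
def varianceProxy (R : ℝ) : ℝ := R + 4 * R ^ 2

instance (x : ℝ) : IsProbabilityMeasure (geomLaw x) := by
  rw [geomLaw]; infer_instance

variable {x R u : ℝ}

theorem varianceProxy_nonneg (hR : 0 ≤ R) : 0 ≤ varianceProxy R := by
  unfold varianceProxy
  positivity

theorem geomMean_pos (hx : 0 < x) : 0 < geomMean x :=
  one_div_pos.2 (sub_pos.2 (Real.one_lt_exp_iff.2 hx))

theorem exp_eq_one_add_one_div_geomMean (x : ℝ) : Real.exp x = 1 + 1 / geomMean x := by
  simp [geomMean]

theorem exp_neg_eq_geomMean_div (hx : 0 < x) : Real.exp (-x) = geomMean x / (1 + geomMean x) := by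
  have hm := geomMean_pos hx
  rw [Real.exp_neg, exp_eq_one_add_one_div_geomMean]
  field_simp
  ring

theorem one_sub_exp_neg_eq (hx : 0 < x) : 1 - Real.exp (-x) = 1 / (1 + geomMean x) := by
  have hm := geomMean_pos hx
  rw [exp_neg_eq_geomMean_div hx]
  field_simp
  ring

theorem coe_projIcc_one_sub_exp_neg (hx : 0 < x) :
    (Set.projIcc (0 : ℝ) 1 zero_le_one (1 - Real.exp (-x)) : ℝ) = 1 - Real.exp (-x) := by
  have h := Real.exp_lt_one_iff.2 (neg_lt_zero.2 hx)
  have h' := Real.exp_pos (-x)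
  rw [Set.projIcc_of_mem zero_le_one ⟨by linarith, by linarith⟩]

theorem projIcc_one_sub_exp_neg_ne_zero (hx : 0 < x) :
    Set.projIcc (0 : ℝ) 1 zero_le_one (1 - Real.exp (-x)) ≠ 0 := by
  rw [Ne, Subtype.ext_iff, coe_projIcc_one_sub_exp_neg hx, Set.Icc.coe_zero, sub_eq_zero]
  exact (Real.exp_lt_one_iff.2 (neg_lt_zero.2 hx)).ne'

theorem geomLaw_real_singleton (hx : 0 < x) (n : ℕ) :
    (geomLaw x).real {n} = (1 - Real.exp (-x)) * Real.exp (-x) ^ n := by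
  rw [geomLaw, geometricMeasure_real_singleton (projIcc_one_sub_exp_neg_ne_zero hx),
    coe_projIcc_one_sub_exp_neg hx]
  ring

theorem integrable_exp_mul_geomLaw (hx : 0 < x) (hu : u < x) :
    Integrable (fun n : ℕ => Real.exp (u * n)) (geomLaw x) := by
  rw [geomLaw, integrable_geometricMeasure_iff (projIcc_one_sub_exp_neg_ne_zero hx),
    coe_projIcc_one_sub_exp_neg hx]
  have hgeom := (summable_geometric_of_lt_one (Real.exp_pos (u - x)).le
    (Real.exp_lt_one_iff.2 (by linarith))).mul_left (1 - Real.exp (-x))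
  refine hgeom.congr fun n => ?_
  rw [Real.norm_eq_abs, Real.abs_exp, sub_sub_cancel, ← Real.exp_nat_mul, ← Real.exp_nat_mul,
    show (n : ℝ) * (u - x) = n * -x + u * n by ring, Real.exp_add]
  ring

theorem mgf_geomLaw (hx : 0 < x) (hu : u < x) :
    mgf (fun n : ℕ => (n : ℝ)) (geomLaw x) u = 1 / (1 - geomMean x * (Real.exp u - 1)) := by
  have hm := geomMean_pos hx
  have hlt : Real.exp (u - x) < 1 := Real.exp_lt_one_iff.2 (by linarith)
  have hratio : Real.exp (u - x) = geomMean x / (1 + geomMean x) * Real.exp u := by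
    rw [sub_eq_neg_add, Real.exp_add, exp_neg_eq_geomMean_div hx]
  have hsum : mgf (fun n : ℕ => (n : ℝ)) (geomLaw x) u
      = ∑' n : ℕ, (1 - Real.exp (-x)) * Real.exp (u - x) ^ n := by
    rw [mgf, geomLaw, integral_geometricMeasure (projIcc_one_sub_exp_neg_ne_zero hx),
      coe_projIcc_one_sub_exp_neg hx]
    refine tsum_congr fun n => ?_
    rw [smul_eq_mul, sub_sub_cancel, ← Real.exp_nat_mul, ← Real.exp_nat_mul,
      show (n : ℝ) * (u - x) = n * -x + u * n by ring, Real.exp_add]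
    ring
  have hden : 1 - Real.exp (u - x)
      = (1 - geomMean x * (Real.exp u - 1)) / (1 + geomMean x) := by
    rw [hratio]; field_simp; ring
  have hden0 : 1 - geomMean x * (Real.exp u - 1) ≠ 0 := by
    intro h0
    rw [h0, zero_div] at hden
    linarith
  rw [hsum, tsum_mul_left, tsum_geometric_of_lt_one (Real.exp_pos _).le hlt, hden,
    one_sub_exp_neg_eq hx]
  field_simp

theorem one_div_one_sub_le_exp {y : ℝ} (hy : |y| ≤ 1 / 2) :
    1 / (1 - y) ≤ Real.exp (y + y ^ 2) := by
  obtain ⟨_, h2⟩ := abs_le.1 hy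
  rw [div_le_iff₀ (by linarith)]
  rcases le_total 0 y with h | h
  · have hexp := Real.quadratic_le_exp_of_nonneg (x := y + y ^ 2) (by positivity)
    have hpoly : 1 ≤ (1 + (y + y ^ 2) + (y + y ^ 2) ^ 2 / 2) * (1 - y) := by
      have : 0 ≤ y ^ 2 * ((1 - y) * (1 + y) ^ 2 / 2 - y) := by
        apply mul_nonneg (sq_nonneg _)
        nlinarith [mul_nonneg h h, mul_nonneg (mul_nonneg h h) (sub_nonneg.2 h2)]
      nlinarith
    exact hpoly.trans (mul_le_mul_of_nonneg_right hexp (by linarith))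
  · have hexp := Real.add_one_le_exp (y + y ^ 2)
    have hpoly : 1 ≤ (y + y ^ 2 + 1) * (1 - y) := by
      have : 0 ≤ y ^ 2 * (-y) := mul_nonneg (sq_nonneg _) (by linarith)
      nlinarith
    exact hpoly.trans (mul_le_mul_of_nonneg_right hexp (by linarith))

theorem abs_geomMean_mul_exp_sub_one_le (hx : 0 < x) (hR : geomMean x ≤ R) (hu : |u| ≤ 1) :
    |geomMean x * (Real.exp u - 1)| ≤ 2 * R * |u| := by
  rw [abs_mul, abs_of_pos (geomMean_pos hx), mul_comm 2 R, mul_assoc]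
  exact mul_le_mul hR (Real.abs_exp_sub_one_le hu) (abs_nonneg _) ((geomMean_pos hx).le.trans hR)

theorem lt_of_geomMean_mul_lt_one (hx : 0 < x) (h : geomMean x * (Real.exp u - 1) < 1) :
    u < x := by
  have hm := geomMean_pos hx
  rw [← Real.exp_lt_exp, exp_eq_one_add_one_div_geomMean x, ← sub_lt_iff_lt_add', lt_div_iff₀ hm]
  linarith

theorem integrable_exp_mul_sub_geomMean (hx : 0 < x) (hu : u < x) :
    Integrable (fun n : ℕ => Real.exp (u * (n - geomMean x))) (geomLaw x) := by
  refine ((integrable_exp_mul_geomLaw hx hu).const_mul (Real.exp (-(u * geomMean x)))).congr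
    (ae_of_all _ fun n => ?_)
  simp only [← Real.exp_add]
  ring_nf

theorem lt_of_four_mul_abs_le_one (hx : 0 < x) (hR : geomMean x ≤ R) (hu : |u| ≤ 1)
    (huR : 4 * R * |u| ≤ 1) : u < x := by
  have h := abs_geomMean_mul_exp_sub_one_le hx hR hu
  exact lt_of_geomMean_mul_lt_one hx (by linarith [le_abs_self (geomMean x * (Real.exp u - 1))])

theorem mgf_sub_geomMean_le (hx : 0 < x) (hR : geomMean x ≤ R) (hu : |u| ≤ 1)
    (huR : 4 * R * |u| ≤ 1) :
    mgf (fun n : ℕ => n - geomMean x) (geomLaw x) u ≤ Real.exp (varianceProxy R * u ^ 2) := by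
  have hm := geomMean_pos hx
  have hquad := (abs_le.1 (Real.abs_exp_sub_one_sub_id_le hu)).2
  set y := geomMean x * (Real.exp u - 1) with hy
  have hya : |y| ≤ 2 * R * |u| := abs_geomMean_mul_exp_sub_one_le hx hR hu
  have hfirst : y - u * geomMean x ≤ R * u ^ 2 := by
    rw [hy, mul_comm u, ← mul_sub]
    exact mul_le_mul hR hquad (by linarith [Real.add_one_le_exp u]) (hm.le.trans hR)
  have hsecond : y ^ 2 ≤ 4 * R ^ 2 * u ^ 2 := by
    calc y ^ 2 = |y| ^ 2 := (sq_abs y).symm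
      _ ≤ (2 * R * |u|) ^ 2 := pow_le_pow_left₀ (abs_nonneg y) hya 2
      _ = 4 * R ^ 2 * u ^ 2 := by rw [mul_pow, sq_abs]; ring
  simp only [sub_eq_neg_add]
  calc mgf (fun n : ℕ => -geomMean x + n) (geomLaw x) u
      = Real.exp (u * -geomMean x) * (1 / (1 - y)) := by
        rw [mgf_const_add, mgf_geomLaw hx (lt_of_four_mul_abs_le_one hx hR hu huR)]
    _ ≤ Real.exp (u * -geomMean x) * Real.exp (y + y ^ 2) := by
        gcongr
        exact one_div_one_sub_le_exp (by linarith)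
    _ = Real.exp (u * -geomMean x + (y + y ^ 2)) := (Real.exp_add _ _).symm
    _ ≤ Real.exp (varianceProxy R * u ^ 2) := by
        rw [varianceProxy]
        gcongr
        linarith

end GeometricLaw

noncomputable section ConfigLaw

open MeasureTheory ProbabilityTheory

variable {ι : Type*} [Fintype ι]

/-- The law of a family of independent geometric variables of ratios `e^{-x_j}`. -/
def configLaw (x : ι → ℝ) : Measure (ι → ℕ) :=
  Measure.pi fun j => geomLaw (x j)

/-- The deviation of the weighted sum `∑ g_j n_j` from its mean under `configLaw x`. -/
def deviation (x g : ι → ℝ) (n : ι → ℕ) : ℝ :=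
  ∑ j, g j * (n j - geomMean (x j))

instance (x : ι → ℝ) : IsProbabilityMeasure (configLaw x) := by
  rw [configLaw]; infer_instance

variable {x g : ι → ℝ} {R u t d : ℝ}

theorem configLaw_real_singleton (hx : ∀ j, 0 < x j) (n : ι → ℕ) :
    (configLaw x).real {n} = ∏ j, (1 - Real.exp (-x j)) * Real.exp (-x j) ^ n j := by
  rw [configLaw, measureReal_def, Measure.pi_singleton, ENNReal.toReal_prod]
  exact prod_congr rfl fun j _ => geomLaw_real_singleton (hx j) (n j)

theorem deviation_neg (x g : ι → ℝ) (n : ι → ℕ) : deviation x (-g) n = -deviation x g n := by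
  simp [deviation]

theorem deviation_smul (x g : ι → ℝ) (d : ℝ) (n : ι → ℕ) :
    deviation x (d • g) n = d * deviation x g n := by
  simp [deviation, mul_sum, mul_assoc]

theorem exp_mul_deviation (x g : ι → ℝ) (u : ℝ) (n : ι → ℕ) :
    Real.exp (u * deviation x g n) = ∏ j, Real.exp (u * g j * (n j - geomMean (x j))) := by
  simp only [deviation, mul_sum, Real.exp_sum, mul_assoc]

theorem abs_mul_le_of_abs_le_one {a b : ℝ} (hb : |b| ≤ 1) : |a * b| ≤ |a| := by
  rw [abs_mul]
  exact mul_le_of_le_one_right (abs_nonneg a) hb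

theorem four_mul_abs_mul_le_one {m : ℝ} {a b : ℝ} (hm : 0 < m) (hR : m ≤ R) (ha : 4 * R * |a| ≤ 1)
    (hb : |b| ≤ 1) : 4 * R * |a * b| ≤ 1 :=
  (mul_le_mul_of_nonneg_left (abs_mul_le_of_abs_le_one hb) (by linarith)).trans ha

theorem integrable_exp_mul_deviation (hx : ∀ j, 0 < x j) (hR : ∀ j, geomMean (x j) ≤ R)
    (hg : ∀ j, |g j| ≤ 1) (hu : |u| ≤ 1) (huR : 4 * R * |u| ≤ 1) :
    Integrable (fun n => Real.exp (u * deviation x g n)) (configLaw x) := by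
  simp only [exp_mul_deviation]
  exact Integrable.fintype_prod (f := fun j (k : ℕ) => Real.exp (u * g j * (k - geomMean (x j))))
    fun j => integrable_exp_mul_sub_geomMean (hx j) <| lt_of_four_mul_abs_le_one (hx j) (hR j)
      ((abs_mul_le_of_abs_le_one (hg j)).trans hu)
      (four_mul_abs_mul_le_one (geomMean_pos (hx j)) (hR j) huR (hg j))

theorem mgf_deviation_le (hx : ∀ j, 0 < x j) (hR : ∀ j, geomMean (x j) ≤ R)
    (hg : ∀ j, |g j| ≤ 1) (hu : |u| ≤ 1) (huR : 4 * R * |u| ≤ 1) :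
    mgf (deviation x g) (configLaw x) u
      ≤ Real.exp (varianceProxy R * u ^ 2 * Fintype.card ι) := by
  have hfactor (j : ι) : mgf (fun n : ℕ => n - geomMean (x j)) (geomLaw (x j)) (u * g j)
      ≤ Real.exp (varianceProxy R * u ^ 2) := by
    have hm := geomMean_pos (hx j)
    have hR0 : 0 ≤ R := hm.le.trans (hR j)
    refine (mgf_sub_geomMean_le (hx j) (hR j) ((abs_mul_le_of_abs_le_one (hg j)).trans hu)
      (four_mul_abs_mul_le_one hm (hR j) huR (hg j))).trans ?_
    have hsq : (u * g j) ^ 2 ≤ u ^ 2 := sq_le_sq.2 (abs_mul_le_of_abs_le_one (hg j))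
    have hQ := varianceProxy_nonneg hR0
    gcongr
  calc mgf (deviation x g) (configLaw x) u
      = ∏ j, mgf (fun n : ℕ => n - geomMean (x j)) (geomLaw (x j)) (u * g j) := by
        simp only [mgf, exp_mul_deviation, configLaw]
        exact integral_fintype_prod_eq_prod
          fun j (k : ℕ) => Real.exp (u * g j * (k - geomMean (x j)))
    _ ≤ ∏ _j : ι, Real.exp (varianceProxy R * u ^ 2) :=
        prod_le_prod (fun _ _ => mgf_nonneg) fun j _ => hfactor j
    _ = Real.exp (varianceProxy R * u ^ 2 * Fintype.card ι) := by
        rw [prod_const, card_univ, ← Real.exp_nat_mul]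
        ring_nf

theorem configLaw_le_deviation (hx : ∀ j, 0 < x j) (hR : ∀ j, geomMean (x j) ≤ R)
    (hg : ∀ j, |g j| ≤ 1) (hu0 : 0 ≤ u) (hu : u ≤ 1) (huR : 4 * R * u ≤ 1) :
    (configLaw x).real {n | t ≤ deviation x g n}
      ≤ Real.exp (-(u * t) + varianceProxy R * u ^ 2 * Fintype.card ι) := by
  rw [← abs_of_nonneg hu0] at hu huR
  rw [Real.exp_add, ← neg_mul]
  refine (measure_ge_le_exp_mul_mgf t hu0
    (integrable_exp_mul_deviation hx hR hg hu huR)).trans ?_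
  gcongr
  exact mgf_deviation_le hx hR hg hu huR

theorem configLaw_le_abs_deviation (hx : ∀ j, 0 < x j) (hR : ∀ j, geomMean (x j) ≤ R)
    (hg : ∀ j, |g j| ≤ 1) (hu0 : 0 ≤ u) (hu : u ≤ 1) (huR : 4 * R * u ≤ 1) :
    (configLaw x).real {n | t ≤ |deviation x g n|}
      ≤ 2 * Real.exp (-(u * t) + varianceProxy R * u ^ 2 * Fintype.card ι) := by
  have hg' (j : ι) : |(-g) j| ≤ 1 := by simpa using hg j
  have hset : {n | t ≤ |deviation x g n|}
      = {n | t ≤ deviation x g n} ∪ {n | t ≤ deviation x (-g) n} := by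
    ext n
    simp only [deviation_neg, Set.mem_ofPred_eq, Set.mem_union, le_abs]
  rw [hset, two_mul]
  exact (measureReal_union_le _ _).trans (add_le_add
    (configLaw_le_deviation hx hR hg hu0 hu huR) (configLaw_le_deviation hx hR hg' hu0 hu huR))

theorem configLaw_mul_lt_abs_deviation (hx : ∀ j, 0 < x j) (hR : ∀ j, geomMean (x j) ≤ R)
    (hd : 0 ≤ d) (hg : ∀ j, |g j| ≤ d) (hu0 : 0 ≤ u) (hu : u ≤ 1) (huR : 4 * R * u ≤ 1) :
    (configLaw x).real {n | d * t < |deviation x g n|}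
      ≤ 2 * Real.exp (-(u * t) + varianceProxy R * u ^ 2 * Fintype.card ι) := by
  rcases hd.eq_or_lt with rfl | hd
  · have hg0 : g = 0 := funext fun j => abs_nonpos_iff.1 (hg j)
    simp only [hg0, deviation, Pi.zero_apply, zero_mul, sum_const_zero, abs_zero, lt_irrefl,
      Set.ofPred_false, measureReal_empty]
    positivity
  · have hscaled : deviation x g = fun n => d * deviation x (d⁻¹ • g) n := by
      ext n
      rw [← deviation_smul, smul_inv_smul₀ hd.ne']
    have hg' (j : ι) : |(d⁻¹ • g) j| ≤ 1 := by
      rw [Pi.smul_apply, smul_eq_mul, abs_mul, abs_of_pos (inv_pos.2 hd), inv_mul_le_one₀ hd]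
      exact hg j
    refine le_trans (measureReal_mono fun n hn => ?_)
      (configLaw_le_abs_deviation (t := t) hx hR hg' hu0 hu huR)
    rw [Set.mem_ofPred_eq, hscaled, abs_mul, abs_of_pos hd] at hn
    exact (lt_of_mul_lt_mul_left hn hd.le).le

theorem one_sub_le_configLaw_abs_deviation (hx : ∀ j, 0 < x j) (hR : ∀ j, geomMean (x j) ≤ R)
    (hd : 0 ≤ d) (hg : ∀ j, |g j| ≤ d) (hu0 : 0 ≤ u) (hu : u ≤ 1) (huR : 4 * R * u ≤ 1) :
    1 - 4 * Real.exp (-(u * t) + varianceProxy R * u ^ 2 * Fintype.card ι)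
      ≤ (configLaw x).real {n | |deviation x 1 n| ≤ t ∧ |deviation x g n| ≤ d * t} := by
  set good := {n : ι → ℕ | |deviation x 1 n| ≤ t ∧ |deviation x g n| ≤ d * t}
  have hone := configLaw_mul_lt_abs_deviation (g := 1) (t := t) hx hR zero_le_one (by simp)
    hu0 hu huR
  have hgen := configLaw_mul_lt_abs_deviation (t := t) hx hR hd hg hu0 hu huR
  have hcover : Set.univ ⊆
      good ∪ ({n | 1 * t < |deviation x 1 n|} ∪ {n | d * t < |deviation x g n|}) := by
    intro n _
    by_cases h : 1 * t < |deviation x 1 n| ∨ d * t < |deviation x g n|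
    · exact Or.inr h
    · rw [not_or, not_lt, not_lt, one_mul] at h
      exact Or.inl h
  have hunion := (measureReal_mono hcover).trans ((measureReal_union_le _ _).trans
    (add_le_add_right (measureReal_union_le _ _) ((configLaw x).real good)))
  rw [probReal_univ] at hunion
  linarith

end ConfigLaw

noncomputable section Configurations

open MeasureTheory ProbabilityTheory

variable {ι : Type*} [Fintype ι] {lam : ι → ℝ} {N : ℕ} {E μ R B β₀ β σ : ℝ}

/-- The configurations of `N` particles on levels of energies `lam j` with total energy at most
`E`. Allocations correspond to such configurations through their increments, with the tail prices
as levels. -/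
def configurations (lam : ι → ℝ) (N : ℕ) (E : ℝ) : Set (ι → ℕ) :=
  {n | ∑ j, n j = N ∧ ∑ j, lam j * n j ≤ E}

/-- `(β, σ)` are the parameters for which the mean configuration under the geometric laws of
exponents `β lam_j - σ` has `N` particles and energy `E`, with energies in `[0, B]`, means in
`[μ, R]` and `0 ≤ β ≤ β₀`. -/
structure IsBoundedEnsemble (lam : ι → ℝ) (N : ℕ) (E μ R B β₀ β σ : ℝ) : Prop where
  exponent_pos : ∀ j, 0 < β * lam j - σ
  total : ∑ j, geomMean (β * lam j - σ) = N
  energy : ∑ j, lam j * geomMean (β * lam j - σ) = E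
  le_mean : ∀ j, μ ≤ geomMean (β * lam j - σ)
  mean_le : ∀ j, geomMean (β * lam j - σ) ≤ R
  level_nonneg : ∀ j, 0 ≤ lam j
  level_le : ∀ j, lam j ≤ B
  nonneg : 0 ≤ β
  le : β ≤ β₀

theorem configurations_finite (lam : ι → ℝ) (N : ℕ) (E : ℝ) : (configurations lam N E).Finite := by
  classical
  refine (Set.finite_Iic fun _ : ι => N).subset fun n hn j => ?_
  exact (single_le_sum (fun _ _ => Nat.zero_le _) (mem_univ j)).trans_eq hn.1

theorem configLaw_real_singleton_zero {x : ι → ℝ} (hx : ∀ j, 0 < x j) :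
    (configLaw x).real {0} = ∏ j, (1 - Real.exp (-x j)) := by
  simp [configLaw_real_singleton hx]

theorem configLaw_real_singleton_eq_exp {x : ι → ℝ} (hx : ∀ j, 0 < x j) (n : ι → ℕ) :
    (configLaw x).real {n} = (configLaw x).real {0} * Real.exp (-∑ j, x j * n j) := by
  rw [configLaw_real_singleton hx, configLaw_real_singleton_zero hx, prod_mul_distrib,
    ← sum_neg_distrib, Real.exp_sum]
  simp only [← Real.exp_nat_mul, mul_neg, mul_comm (x _)]

/-- The probability under `configLaw` of a configuration of `N` particles and energy exactly `E`. -/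
def boltzmannWeight (lam : ι → ℝ) (N : ℕ) (E β σ : ℝ) : ℝ :=
  (configLaw fun j => β * lam j - σ).real {0} * Real.exp (σ * N - β * E)

theorem configLaw_real_singleton_eq_boltzmannWeight (hx : ∀ j, 0 < β * lam j - σ) {n : ι → ℕ}
    (hn : ∑ j, n j = N) :
    (configLaw fun j => β * lam j - σ).real {n}
      = boltzmannWeight lam N E β σ * Real.exp (β * (E - ∑ j, lam j * n j)) := by
  have hN : (N : ℝ) = ∑ j, (n j : ℝ) := by rw [← hn, Nat.cast_sum]
  rw [configLaw_real_singleton_eq_exp hx, boltzmannWeight, mul_assoc, ← Real.exp_add, hN]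
  congr 2
  simp only [sub_mul, sum_sub_distrib, mul_assoc, ← mul_sum]
  ring

theorem boltzmannWeight_pos (hx : ∀ j, 0 < β * lam j - σ) : 0 < boltzmannWeight lam N E β σ := by
  refine mul_pos ?_ (Real.exp_pos _)
  rw [configLaw_real_singleton_zero hx]
  exact prod_pos fun j _ => sub_pos.2 (Real.exp_lt_one_iff.2 (neg_lt_zero.2 (hx j)))

theorem boltzmannWeight_le (hx : ∀ j, 0 < β * lam j - σ) (hβ : 0 ≤ β) {n : ι → ℕ}
    (hn : n ∈ configurations lam N E) :
    boltzmannWeight lam N E β σ ≤ (configLaw fun j => β * lam j - σ).real {n} := by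
  rw [configLaw_real_singleton_eq_boltzmannWeight hx hn.1]
  exact le_mul_of_one_le_right (boltzmannWeight_pos hx).le
    (Real.one_le_exp (mul_nonneg hβ (sub_nonneg.2 hn.2)))

theorem sum_measureReal_singleton_eq_of_finite {Ω : Type*} [MeasurableSpace Ω]
    [MeasurableSingletonClass Ω] (P : Measure Ω) [SigmaFinite P] {S : Set Ω} (hS : S.Finite) :
    ∑ ω ∈ hS.toFinset, P.real {ω} = P.real S := by
  rw [sum_measureReal_singleton, hS.coe_toFinset]

theorem ncard_mul_le_measureReal {Ω : Type*} [MeasurableSpace Ω] [MeasurableSingletonClass Ω]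
    {P : Measure Ω} [SigmaFinite P] {S : Set Ω} (hS : S.Finite) {c : ℝ}
    (hc : ∀ ω ∈ S, c ≤ P.real {ω}) : S.ncard * c ≤ P.real S := by
  rw [← sum_measureReal_singleton_eq_of_finite P hS, Set.ncard_eq_toFinset_card S hS,
    ← nsmul_eq_mul]
  exact card_nsmul_le_sum _ _ _ fun ω hω => hc ω (hS.mem_toFinset.1 hω)

theorem measureReal_le_ncard_mul {Ω : Type*} [MeasurableSpace Ω] [MeasurableSingletonClass Ω]
    {P : Measure Ω} [SigmaFinite P] {S : Set Ω} (hS : S.Finite) {c : ℝ}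
    (hc : ∀ ω ∈ S, P.real {ω} ≤ c) : P.real S ≤ S.ncard * c := by
  rw [← sum_measureReal_singleton_eq_of_finite P hS, Set.ncard_eq_toFinset_card S hS,
    ← nsmul_eq_mul]
  exact sum_le_card_nsmul _ _ _ fun ω hω => hc ω (hS.mem_toFinset.1 hω)

/-- Conditioning on the constraints is free up to the factor `boltzmannWeight`: every configuration
has at least this probability, so few configurations deviate much. -/
theorem ncard_deviating_mul_boltzmannWeight_le (hx : ∀ j, 0 < β * lam j - σ) (hβ : 0 ≤ β)
    (hR : ∀ j, geomMean (β * lam j - σ) ≤ R) {u t : ℝ} (hu0 : 0 ≤ u) (hu : u ≤ 1)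
    (huR : 4 * R * u ≤ 1) (𝒢 : Finset (ι → ℝ)) (h𝒢 : ∀ g ∈ 𝒢, ∀ j, |g j| ≤ 1) :
    ({n ∈ configurations lam N E | ∃ g ∈ 𝒢, t ≤ |deviation (fun j => β * lam j - σ) g n|}.ncard : ℝ)
        * boltzmannWeight lam N E β σ
      ≤ #𝒢 * (2 * Real.exp (-(u * t) + varianceProxy R * u ^ 2 * Fintype.card ι)) := by
  set x : ι → ℝ := fun j => β * lam j - σ
  calc _ ≤ (configLaw x).real {n ∈ configurations lam N E | ∃ g ∈ 𝒢, t ≤ |deviation x g n|} :=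
        ncard_mul_le_measureReal ((configurations_finite lam N E).subset (Set.sep_subset _ _))
          fun n hn => boltzmannWeight_le hx hβ hn.1
    _ ≤ (configLaw x).real (⋃ g ∈ 𝒢, {n | t ≤ |deviation x g n|}) :=
        measureReal_mono (fun n hn => by simpa using hn.2) (measure_ne_top _ _)
    _ ≤ ∑ g ∈ 𝒢, (configLaw x).real {n | t ≤ |deviation x g n|} :=
        measureReal_biUnion_finset_le _ _
    _ ≤ _ := by
        rw [← nsmul_eq_mul]
        exact sum_le_card_nsmul _ _ _ fun g hg =>
          configLaw_le_abs_deviation hx hR (h𝒢 g hg) hu0 hu huR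

end Configurations

noncomputable section Filling

open MeasureTheory ProbabilityTheory

variable {ι : Type*} {I : Finset ι} {i₀ : ι}

open Classical in
/-- The extension of a configuration on `I` to all levels that puts `k` particles on the level
`i₀` and none on the other levels outside `I`. -/
def fill (I : Finset ι) (i₀ : ι) (k : ℕ) (n : I → ℕ) (j : ι) : ℕ :=
  if h : j ∈ I then n ⟨j, h⟩ else if j = i₀ then k else 0

theorem fill_coe (k : ℕ) (n : I → ℕ) (j : I) : fill I i₀ k n j = n j := by
  simp [fill]

theorem fill_self (hi₀ : i₀ ∉ I) (k : ℕ) (n : I → ℕ) : fill I i₀ k n i₀ = k := by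
  simp [fill, hi₀]

theorem fill_of_ne {j : ι} (hj : j ∉ I) (hne : j ≠ i₀) (k : ℕ) (n : I → ℕ) :
    fill I i₀ k n j = 0 := by
  simp [fill, hj, hne]

theorem injective_fill (i₀ : ι) (k : (I → ℕ) → ℕ) :
    Function.Injective fun n : I → ℕ => fill I i₀ (k n) n := fun n n' h =>
  funext fun j => by rw [← fill_coe (k n) n j, ← fill_coe (k n') n' j]; exact congrFun h j

variable [Fintype ι] {lam : ι → ℝ} {N L : ℕ} {E μ R B β₀ β σ : ℝ}

theorem sum_mul_fill (hi₀ : i₀ ∉ I) (f : ι → ℝ) (k : ℕ) (n : I → ℕ) :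
    ∑ j, f j * fill I i₀ k n j = ∑ j : I, f j * n j + f i₀ * k := by
  classical
  rw [← sum_add_sum_compl I, ← sum_coe_sort I,
    sum_eq_single_of_mem i₀ (mem_compl.2 hi₀), fill_self hi₀]
  · simp only [fill_coe]
  · intro j hj hne
    rw [fill_of_ne (mem_compl.1 hj) hne, Nat.cast_zero, mul_zero]

theorem sum_fill_eq (hi₀ : i₀ ∉ I) (n : I → ℕ) (hn : ∑ j, n j ≤ N) :
    ∑ j, fill I i₀ (N - ∑ j, n j) n j = N := by
  have hsum := sum_mul_fill hi₀ (fun _ => 1) (N - ∑ j, n j) n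
  simp only [one_mul] at hsum
  rw [← Nat.cast_sum, ← Nat.cast_sum, ← Nat.cast_add, Nat.add_sub_cancel' hn] at hsum
  exact_mod_cast hsum

theorem configLaw_real_singleton_fill [DecidableEq ι] (hi₀ : i₀ ∉ I) {x : ι → ℝ}
    (hx : ∀ j, 0 < x j) (k : ℕ) (n : I → ℕ) :
    (configLaw x).real {fill I i₀ k n}
      = (configLaw fun j : I => x j).real {n} *
        ((∏ j ∈ Iᶜ, (1 - Real.exp (-x j))) * Real.exp (-(x i₀ * k))) := by
  have hI : ∀ j : I, 0 < x j := fun j => hx j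
  rw [configLaw_real_singleton_eq_exp hx, configLaw_real_singleton_eq_exp hI,
    configLaw_real_singleton_zero hx, configLaw_real_singleton_zero hI, sum_mul_fill hi₀,
    ← prod_mul_prod_compl I, ← prod_coe_sort I, neg_add, Real.exp_add]
  ring

theorem exp_neg_le_one_sub_exp_neg {x : ℝ} (hx : 0 < x) (hR : geomMean x ≤ R) :
    Real.exp (-R) ≤ 1 - Real.exp (-x) := by
  have hm := geomMean_pos hx
  rw [one_sub_exp_neg_eq hx, Real.exp_neg, ← one_div]
  exact one_div_le_one_div_of_le (by linarith) (by linarith [Real.add_one_le_exp R])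

theorem le_one_div_of_le_geomMean {x : ℝ} (hμ : 0 < μ) (h : μ ≤ geomMean x) : x ≤ 1 / μ := by
  have hinv : 1 / geomMean x ≤ 1 / μ := one_div_le_one_div_of_le hμ h
  linarith [Real.add_one_le_exp x, exp_eq_one_add_one_div_geomMean x]

theorem configLaw_real_singleton_le_fill [DecidableEq ι] (hi₀ : i₀ ∉ I) {x : ι → ℝ}
    (hx : ∀ j, 0 < x j) (hR : ∀ j, geomMean (x j) ≤ R) (hμ : 0 < μ) (hμi₀ : μ ≤ geomMean (x i₀))
    (k : ℕ) (n : I → ℕ) :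
    (configLaw fun j : I => x j).real {n}
      ≤ (configLaw x).real {fill I i₀ k n} * Real.exp (R * #Iᶜ + k / μ) := by
  have hfactors : Real.exp (-(R * #Iᶜ)) ≤ ∏ j ∈ Iᶜ, (1 - Real.exp (-x j)) := by
    calc Real.exp (-(R * #Iᶜ)) = ∏ _j ∈ Iᶜ, Real.exp (-R) := by
          rw [prod_const, ← Real.exp_nat_mul]; ring_nf
      _ ≤ _ := prod_le_prod (fun _ _ => (Real.exp_pos _).le)
          fun j _ => exp_neg_le_one_sub_exp_neg (hx j) (hR j)
  have hfiller : Real.exp (-(k / μ)) ≤ Real.exp (-(x i₀ * k)) := by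
    have := mul_le_mul_of_nonneg_right (le_one_div_of_le_geomMean hμ hμi₀)
      (Nat.cast_nonneg (α := ℝ) k)
    gcongr
    rwa [one_div_mul_eq_div] at this
  have hweight : Real.exp (-(R * #Iᶜ + k / μ))
      ≤ (∏ j ∈ Iᶜ, (1 - Real.exp (-x j))) * Real.exp (-(x i₀ * k)) := by
    rw [neg_add, Real.exp_add]
    exact mul_le_mul hfactors hfiller (Real.exp_pos _).le ((Real.exp_pos _).le.trans hfactors)
  rw [configLaw_real_singleton_fill hi₀ hx, mul_assoc]
  refine le_mul_of_one_le_right measureReal_nonneg ?_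
  rwa [← div_le_iff₀ (Real.exp_pos _), one_div, ← Real.exp_neg]

/-- `T` is a set of highest levels, separated from the other levels by the level `i₁`, and `i₀` is a
lowest level outside `T`. -/
structure IsLevelSplit (lam : ι → ℝ) (T : Finset ι) (i₀ i₁ : ι) : Prop where
  bottom_notMem : i₀ ∉ T
  bottom_le : ∀ j, lam i₀ ≤ lam j
  le_of_mem : ∀ j ∈ T, lam i₁ ≤ lam j
  le_of_notMem : ∀ j ∉ T, lam j ≤ lam i₁

theorem exists_card_eq_forall_le (lam : ι → ℝ) (hL : L ≤ Fintype.card ι) :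
    ∃ T : Finset ι, #T = L ∧ ∀ j ∈ T, ∀ k ∉ T, lam k ≤ lam j := by
  classical
  induction L with
  | zero => exact ⟨∅, rfl, by simp⟩
  | succ L ih =>
    obtain ⟨T, hT, hle⟩ := ih (by omega)
    have hne : Tᶜ.Nonempty := by rw [← card_pos, card_compl]; omega
    obtain ⟨i, hi, hmax⟩ := exists_max_image Tᶜ lam hne
    rw [mem_compl] at hi
    refine ⟨insert i T, by rw [card_insert_of_notMem hi, hT], fun j hj k hk => ?_⟩
    rw [mem_insert, not_or] at hk
    rcases mem_insert.1 hj with rfl | hj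
    · exact hmax k (mem_compl.2 hk.2)
    · exact hle j hj k hk.2

theorem exists_isLevelSplit (lam : ι → ℝ) (hL : L < Fintype.card ι) :
    ∃ T i₀ i₁, #T = L ∧ IsLevelSplit lam T i₀ i₁ := by
  classical
  obtain ⟨T, hT, hle⟩ := exists_card_eq_forall_le lam hL.le
  have hne : Tᶜ.Nonempty := by rw [← card_pos, card_compl]; omega
  obtain ⟨i₁, hi₁, hmax⟩ := exists_max_image Tᶜ lam hne
  obtain ⟨i₀, hi₀, hmin⟩ := exists_min_image Tᶜ lam hne
  simp only [mem_compl] at hi₁ hi₀ hmax hmin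
  refine ⟨T, i₀, i₁, hT, hi₀, fun j => ?_, fun j hj => hle j hj i₁ hi₁, hmax⟩
  by_cases hj : j ∈ T
  · exact hle j hj i₀ hi₀
  · exact hmin j hj

variable [DecidableEq ι] {T : Finset ι} {i₁ : ι}

theorem sum_mul_geomMean_sub_sum_coe (hi₀ : i₀ ∉ T) (x f : ι → ℝ)
    (n : ((insert i₀ T)ᶜ : Finset ι) → ℕ) :
    ∑ j, f j * geomMean (x j) - ∑ j : ((insert i₀ T)ᶜ : Finset ι), f j * n j
      = f i₀ * geomMean (x i₀) + ∑ j ∈ T, f j * geomMean (x j)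
        - deviation (fun j : ((insert i₀ T)ᶜ : Finset ι) => x j) (fun j => f j) n := by
  rw [← sum_add_sum_compl (insert i₀ T), sum_insert hi₀, deviation,
    ← sum_coe_sort (insert i₀ T)ᶜ]
  simp only [mul_sub, sum_sub_distrib]
  ring

variable {n : ((insert i₀ T)ᶜ : Finset ι) → ℕ}

theorem IsBoundedEnsemble.sub_sum_mem_Icc (h : IsBoundedEnsemble lam N E μ R B β₀ β σ)
    (hμ : 0 ≤ μ) (hT : T.Nonempty) (hi₀ : i₀ ∉ T)
    (hn : |deviation (fun j : ((insert i₀ T)ᶜ : Finset ι) => β * lam j - σ) 1 n| ≤ μ * #T) :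
    (N : ℝ) - ∑ j, (n j : ℝ) ∈ Set.Icc 0 (3 * R * #T) := by
  have hsplit := sum_mul_geomMean_sub_sum_coe hi₀ (fun j => β * lam j - σ) 1 n
  simp only [Pi.one_apply, one_mul, h.total] at hsplit
  change _ = _ - deviation _ 1 n at hsplit
  have hlower : #T * μ ≤ ∑ j ∈ T, geomMean (β * lam j - σ) := by
    rw [← nsmul_eq_mul]; exact card_nsmul_le_sum _ _ _ fun j _ => h.le_mean j
  have hupper : ∑ j ∈ T, geomMean (β * lam j - σ) ≤ #T * R := by
    rw [← nsmul_eq_mul]; exact sum_le_card_nsmul _ _ _ fun j _ => h.mean_le j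
  have hcard : (1 : ℝ) ≤ #T := by exact_mod_cast hT.card_pos
  have hμR : μ ≤ R := (h.le_mean i₀).trans (h.mean_le i₀)
  have hbottom : geomMean (β * lam i₀ - σ) ≤ R * #T :=
    (h.mean_le i₀).trans (le_mul_of_one_le_right (hμ.trans hμR) hcard)
  have hdev := abs_le.1 hn
  rw [hsplit]
  constructor
  · linarith [h.le_mean i₀]
  · linarith [mul_le_mul_of_nonneg_right hμR (Nat.cast_nonneg (α := ℝ) #T)]

theorem IsBoundedEnsemble.sub_sum_fill_mem_Icc (h : IsBoundedEnsemble lam N E μ R B β₀ β σ)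
    (hμ : 0 ≤ μ) (hsplit : IsLevelSplit lam T i₀ i₁) {k : ℕ}
    (htotal : ∑ j, fill (insert i₀ T)ᶜ i₀ k n j = N)
    (hn : |deviation (fun j : ((insert i₀ T)ᶜ : Finset ι) => β * lam j - σ)
      (fun j => lam j - lam i₀) n| ≤ (lam i₁ - lam i₀) * (μ * #T)) :
    E - ∑ j, lam j * fill (insert i₀ T)ᶜ i₀ k n j ∈ Set.Icc 0 (2 * B * R * #T) := by
  have hi₀ : i₀ ∉ (insert i₀ T)ᶜ := by simp
  have hN : (N : ℝ) = ∑ j, (fill (insert i₀ T)ᶜ i₀ k n j : ℝ) := by rw [← htotal, Nat.cast_sum]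
  have hgap : E - ∑ j, lam j * fill (insert i₀ T)ᶜ i₀ k n j
      = ∑ j ∈ T, (lam j - lam i₀) * geomMean (β * lam j - σ)
        - deviation (fun j : ((insert i₀ T)ᶜ : Finset ι) => β * lam j - σ)
          (fun j => lam j - lam i₀) n := by
    have hmeans := sum_mul_geomMean_sub_sum_coe hsplit.bottom_notMem (fun j => β * lam j - σ)
      (fun j => lam j - lam i₀) n
    have hfill := sum_mul_fill hi₀ (fun j => lam j - lam i₀) k n
    simp only [sub_mul, sum_sub_distrib, ← mul_sum, h.energy, h.total, ← hN] at hmeans hfill ⊢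
    linarith
  have hmean_nonneg (j : ι) : 0 ≤ geomMean (β * lam j - σ) := hμ.trans (h.le_mean j)
  have hR : 0 ≤ R := (hmean_nonneg i₀).trans (h.mean_le i₀)
  have hlower : #T * ((lam i₁ - lam i₀) * μ)
      ≤ ∑ j ∈ T, (lam j - lam i₀) * geomMean (β * lam j - σ) := by
    rw [← nsmul_eq_mul]
    exact card_nsmul_le_sum _ _ _ fun j hj => mul_le_mul
      (sub_le_sub_right (hsplit.le_of_mem j hj) _) (h.le_mean j) hμ
      (sub_nonneg.2 (hsplit.bottom_le j))
  have hupper : ∑ j ∈ T, (lam j - lam i₀) * geomMean (β * lam j - σ) ≤ #T * (B * R) := by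
    rw [← nsmul_eq_mul]
    exact sum_le_card_nsmul _ _ _ fun j _ => mul_le_mul
      (by linarith [h.level_le j, h.level_nonneg i₀]) (h.mean_le j) (hmean_nonneg j)
      ((h.level_nonneg j).trans (h.level_le j))
  have hB : (lam i₁ - lam i₀) * (μ * #T) ≤ B * (R * #T) := by
    gcongr
    · exact (h.level_nonneg i₀).trans (h.level_le i₀)
    · linarith [h.level_nonneg i₀, h.level_le i₁]
    · exact (h.le_mean i₀).trans (h.mean_le i₀)
  have hdev := abs_le.1 hn
  rw [hgap]
  constructor <;> linarith

/-- The exponential rate, per reserved level, at which filling a configuration on the unreserved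
levels changes its probability. -/
def fillingCost (μ R B β₀ : ℝ) : ℝ := 2 * β₀ * B * R + 2 * R + 3 * R / μ

theorem IsBoundedEnsemble.fill_mem_configurations (h : IsBoundedEnsemble lam N E μ R B β₀ β σ)
    (hμ : 0 < μ) (hT : T.Nonempty) (hsplit : IsLevelSplit lam T i₀ i₁)
    (hone : |deviation (fun j : ((insert i₀ T)ᶜ : Finset ι) => β * lam j - σ) 1 n| ≤ μ * #T)
    (hlam : |deviation (fun j : ((insert i₀ T)ᶜ : Finset ι) => β * lam j - σ)
      (fun j => lam j - lam i₀) n| ≤ (lam i₁ - lam i₀) * (μ * #T)) :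
    fill (insert i₀ T)ᶜ i₀ (N - ∑ j, n j) n ∈ configurations lam N E ∧
      (configLaw fun j : ((insert i₀ T)ᶜ : Finset ι) => β * lam j - σ).real {n}
        ≤ boltzmannWeight lam N E β σ * Real.exp (fillingCost μ R B β₀ * #T) := by
  have hi₀ : i₀ ∉ (insert i₀ T)ᶜ := by simp
  obtain ⟨hle, hk⟩ := h.sub_sum_mem_Icc hμ.le hT hsplit.bottom_notMem hone
  rw [← Nat.cast_sum, sub_nonneg, Nat.cast_le] at hle
  rw [← Nat.cast_sum, ← Nat.cast_sub hle] at hk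
  have htotal := sum_fill_eq hi₀ n hle
  obtain ⟨hE, hgap⟩ := h.sub_sum_fill_mem_Icc hμ.le hsplit htotal hlam
  refine ⟨⟨htotal, sub_nonneg.1 hE⟩, ?_⟩
  have hcard : (#(insert i₀ T)ᶜᶜ : ℝ) ≤ 2 * #T := by
    rw [compl_compl, card_insert_of_notMem hsplit.bottom_notMem]
    have := hT.card_pos
    exact_mod_cast (by omega : #T + 1 ≤ 2 * #T)
  have hR : 0 ≤ R := hμ.le.trans ((h.le_mean i₀).trans (h.mean_le i₀))
  refine (configLaw_real_singleton_le_fill hi₀ h.exponent_pos h.mean_le hμ (h.le_mean i₀)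
    (N - ∑ j, n j) n).trans ?_
  rw [configLaw_real_singleton_eq_boltzmannWeight h.exponent_pos htotal, mul_assoc,
    ← Real.exp_add]
  refine mul_le_mul_of_nonneg_left (Real.exp_le_exp.2 ?_) (boltzmannWeight_pos h.exponent_pos).le
  have henergy := mul_le_mul h.le hgap hE (h.nonneg.trans h.le)
  have hlevels := mul_le_mul_of_nonneg_left hcard hR
  have hfiller := div_le_div_of_nonneg_right hk hμ.le
  calc _ ≤ β₀ * (2 * B * R * #T) + (R * (2 * #T) + 3 * R * #T / μ) :=
        add_le_add henergy (add_le_add hlevels hfiller)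
    _ = fillingCost μ R B β₀ * #T := by rw [fillingCost]; ring

end Filling

section Counting

open MeasureTheory

variable {ι : Type*} [Fintype ι] {lam : ι → ℝ} {N L : ℕ} {E μ R B β₀ β σ : ℝ}

/-- Reserve the `L` highest levels for no particles and the lowest one for balancing the number of
particles: the energy saved on the reserved levels absorbs the fluctuations on all the others, so
typical configurations on the other levels extend to configurations that meet the constraints. -/
theorem IsBoundedEnsemble.one_sub_le_ncard_configurations_mul
    (h : IsBoundedEnsemble lam N E μ R B β₀ β σ) (hμ : 0 < μ) (hL : 0 < L)
    (hLι : L < Fintype.card ι) {u : ℝ} (hu0 : 0 ≤ u) (hu : u ≤ 1) (huR : 4 * R * u ≤ 1) :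
    1 - 4 * Real.exp (-(u * (μ * L)) + varianceProxy R * u ^ 2 * Fintype.card ι)
      ≤ (configurations lam N E).ncard *
        (boltzmannWeight lam N E β σ * Real.exp (fillingCost μ R B β₀ * L)) := by
  classical
  obtain ⟨T, i₀, i₁, rfl, hsplit⟩ := exists_isLevelSplit lam hLι
  set I := (insert i₀ T)ᶜ
  set x : I → ℝ := fun j => β * lam j - σ
  set typical : Set (I → ℕ) := {n | |deviation x 1 n| ≤ μ * #T ∧
    |deviation x (fun j => lam j - lam i₀) n| ≤ (lam i₁ - lam i₀) * (μ * #T)}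
  have hfill (n) (hn : n ∈ typical) :=
    h.fill_mem_configurations hμ (card_pos.1 hL) hsplit hn.1 hn.2
  have hfinite : typical.Finite := Set.Finite.of_injOn (fun n hn => (hfill n hn).1)
    (injective_fill i₀ _).injOn (configurations_finite lam N E)
  have hcard : typical.ncard ≤ (configurations lam N E).ncard := Set.ncard_le_ncard_of_injOn _
    (fun n hn => (hfill n hn).1) (injective_fill i₀ _).injOn (configurations_finite lam N E)
  have hd (j : I) : |lam j - lam i₀| ≤ lam i₁ - lam i₀ := by
    have hj := mem_compl.1 j.2
    rw [mem_insert, not_or] at hj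
    rw [abs_of_nonneg (sub_nonneg.2 (hsplit.bottom_le j))]
    exact sub_le_sub_right (hsplit.le_of_notMem j hj.2) _
  have hQ := varianceProxy_nonneg (hμ.le.trans ((h.le_mean i₀).trans (h.mean_le i₀)))
  calc 1 - 4 * Real.exp (-(u * (μ * #T)) + varianceProxy R * u ^ 2 * Fintype.card ι)
      ≤ 1 - 4 * Real.exp (-(u * (μ * #T)) + varianceProxy R * u ^ 2 * Fintype.card I) := by
        gcongr
        rw [Fintype.card_coe]
        exact card_le_univ I
    _ ≤ (configLaw x).real typical := one_sub_le_configLaw_abs_deviation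
        (fun j => h.exponent_pos j) (fun j => h.mean_le j) (sub_nonneg.2 (hsplit.bottom_le i₁))
        hd hu0 hu huR
    _ ≤ typical.ncard * (boltzmannWeight lam N E β σ * Real.exp (fillingCost μ R B β₀ * #T)) :=
        measureReal_le_ncard_mul hfinite fun n hn => (hfill n hn).2
    _ ≤ _ := by
        have := boltzmannWeight_pos (N := N) (E := E) h.exponent_pos
        gcongr

theorem IsBoundedEnsemble.ncard_deviating_le (h : IsBoundedEnsemble lam N E μ R B β₀ β σ)
    (hμ : 0 < μ) (hL : 0 < L) (hLι : L < Fintype.card ι) {u v t : ℝ}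
    (hu0 : 0 ≤ u) (hu : u ≤ 1) (huR : 4 * R * u ≤ 1)
    (hv0 : 0 ≤ v) (hv : v ≤ 1) (hvR : 4 * R * v ≤ 1)
    (hsmall : 4 * Real.exp (-(u * (μ * L)) + varianceProxy R * u ^ 2 * Fintype.card ι) ≤ 1 / 2)
    (𝒢 : Finset (ι → ℝ)) (h𝒢 : ∀ g ∈ 𝒢, ∀ j, |g j| ≤ 1) :
    ({n ∈ configurations lam N E | ∃ g ∈ 𝒢, t ≤ |deviation (fun j => β * lam j - σ) g n|}.ncard : ℝ)
      ≤ 4 * #𝒢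
        * Real.exp (fillingCost μ R B β₀ * L + varianceProxy R * v ^ 2 * Fintype.card ι - v * t)
        * (configurations lam N E).ncard := by
  have hlower := h.one_sub_le_ncard_configurations_mul hμ hL hLι hu0 hu huR
  have hupper := ncard_deviating_mul_boltzmannWeight_le (N := N) (E := E) (t := t) h.exponent_pos
    h.nonneg h.mean_le hv0 hv hvR 𝒢 h𝒢
  have hweight := boltzmannWeight_pos (N := N) (E := E) h.exponent_pos
  refine le_of_mul_le_mul_right (hupper.trans ?_) hweight
  have hhalf : 1 ≤ 2 * ((configurations lam N E).ncard *
      (boltzmannWeight lam N E β σ * Real.exp (fillingCost μ R B β₀ * L))) := by linarith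
  calc _ ≤ #𝒢 * (2 * Real.exp (-(v * t) + varianceProxy R * v ^ 2 * Fintype.card ι)) *
        (2 * ((configurations lam N E).ncard *
          (boltzmannWeight lam N E β σ * Real.exp (fillingCost μ R B β₀ * L)))) :=
        le_mul_of_one_le_right (by positivity) hhalf
    _ = _ := by
        rw [show fillingCost μ R B β₀ * L + varianceProxy R * v ^ 2 * Fintype.card ι - v * t
          = -(v * t) + varianceProxy R * v ^ 2 * Fintype.card ι + fillingCost μ R B β₀ * L by ring,
          Real.exp_add _ (fillingCost μ R B β₀ * L)]
        ring

end Counting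

noncomputable section Allocations

variable {s K M : ℕ} {p : ℕ → ℝ} {Φ β σ : ℝ} {C : ℕ → ℕ}

theorem tailPrice_nonneg (hp : ∀ i ∈ Icc 1 s, 0 ≤ p i) {j : ℕ} (hj : 1 ≤ j) :
    0 ≤ tailPrice s p j :=
  sum_nonneg fun k hk => hp k (by rw [mem_Icc] at hk ⊢; omega)

theorem tailPrice_le_tailPrice (hp : ∀ i ∈ Icc 1 s, 0 ≤ p i) {i j : ℕ} (hi : 1 ≤ i)
    (hij : i ≤ j) : tailPrice s p j ≤ tailPrice s p i := by
  refine sum_le_sum_of_subset_of_nonneg (Icc_subset_Icc_left hij) fun k hk _ => hp k ?_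
  rw [mem_Icc] at hk ⊢
  omega

theorem sum_mul_sum_Icc_two_eq {r : ℕ} (hr : r ≤ 2) (s : ℕ) (p a : ℕ → ℝ) :
    ∑ i ∈ Icc r s, p i * ∑ j ∈ Icc 2 i, a j = ∑ j ∈ Icc 2 s, tailPrice s p j * a j := by
  simp only [tailPrice, mul_sum, sum_mul]
  refine sum_comm' fun i j => ?_
  simp only [mem_Icc]
  omega

/-- The sequence `C_1, …, C_s` with `C_1 = K` and the increments `n`, as encoded in
`IsAllocation`. -/
def accumulate (s K : ℕ) (n : ℕ → ℕ) (i : ℕ) : ℕ :=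
  if i ∈ Icc 1 s then K + ∑ j ∈ Icc 2 i, n j else 0

/-- The increments `C_j - C_{j-1}`, `2 ≤ j ≤ s`, of a sequence. -/
def increments (s : ℕ) (C : ℕ → ℕ) (j : Icc 2 s) : ℕ := C j - C (j - 1)

/-- The extension by zero of a sequence indexed by `2, …, s`. -/
def extendByZero {s : ℕ} (n : Icc 2 s → ℕ) (j : ℕ) : ℕ :=
  if h : j ∈ Icc 2 s then n ⟨j, h⟩ else 0

theorem extendByZero_coe (n : Icc 2 s → ℕ) (j : Icc 2 s) : extendByZero n j = n j :=
  dif_pos j.2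

theorem accumulate_of_mem {n : ℕ → ℕ} {i : ℕ} (hi : i ∈ Icc 1 s) :
    accumulate s K n i = K + ∑ j ∈ Icc 2 i, n j := if_pos hi

theorem IsAllocation.first_eq (h : IsAllocation s K M p Φ C) : C 1 = K := by
  have := h.lower
  have := h.upper
  have := h.total
  omega

theorem IsAllocation.last_eq (h : IsAllocation s K M p Φ C) : C s = M := by
  have := h.lower
  have := h.upper
  have := h.total
  omega

theorem IsAllocation.eq_add_sum (h : IsAllocation s K M p Φ C) {i : ℕ} (hi : 1 ≤ i)
    (his : i ≤ s) : C i = K + ∑ j ∈ Icc 2 i, extendByZero (increments s C) j := by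
  induction i, hi using Nat.le_induction with
  | base => simp [h.first_eq]
  | succ i hi ih =>
    have hincr : extendByZero (increments s C) (i + 1) = C (i + 1) - C i :=
      dif_pos (mem_Icc.2 ⟨by omega, his⟩)
    rw [sum_Icc_succ_top (by omega), ← add_assoc, ← ih (by omega), hincr]
    have := h.ordered i (by rw [mem_Ico]; omega)
    omega

theorem IsAllocation.accumulate_increments (h : IsAllocation s K M p Φ C) :
    accumulate s K (extendByZero (increments s C)) = C := by
  funext i
  by_cases hi : i ∈ Icc 1 s
  · rw [accumulate_of_mem hi, ← h.eq_add_sum (mem_Icc.1 hi).1 (mem_Icc.1 hi).2]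
  · rw [accumulate, if_neg hi, h.support i hi]

theorem injOn_increments : Set.InjOn (increments s) (allocations s K M p Φ) := by
  intro C hC D hD hCD
  rw [← IsAllocation.accumulate_increments hC, ← IsAllocation.accumulate_increments hD, hCD]

theorem increments_accumulate (n : Icc 2 s → ℕ) :
    increments s (accumulate s K (extendByZero n)) = n := by
  funext ⟨j, hj⟩
  obtain ⟨k, rfl⟩ : ∃ k, j = k + 1 := ⟨j - 1, by rw [mem_Icc] at hj; omega⟩
  have hk := mem_Icc.1 hj
  calc increments s (accumulate s K (extendByZero n)) ⟨k + 1, hj⟩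
      = accumulate s K (extendByZero n) (k + 1) - accumulate s K (extendByZero n) k := rfl
    _ = extendByZero n (k + 1) := by
      rw [accumulate_of_mem (by rw [mem_Icc]; omega), accumulate_of_mem (by rw [mem_Icc]; omega),
        sum_Icc_succ_top (by omega), ← add_assoc, Nat.add_sub_cancel_left]
    _ = n ⟨k + 1, hj⟩ := extendByZero_coe n ⟨k + 1, hj⟩

theorem sum_accumulate_mul (s K : ℕ) (p : ℕ → ℝ) (n : ℕ → ℕ) :
    ∑ i ∈ Icc 1 s, (accumulate s K n i : ℝ) * p i
      = K * ∑ i ∈ Icc 1 s, p i + ∑ j ∈ Icc 2 s, tailPrice s p j * n j := by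
  rw [← sum_mul_sum_Icc_two_eq one_le_two, mul_sum, ← sum_add_distrib]
  refine sum_congr rfl fun i hi => ?_
  rw [accumulate_of_mem hi]
  push_cast
  ring

theorem isAllocation_accumulate (hs : 1 ≤ s) (hKM : K ≤ M) (hp : ∀ i ∈ Icc 1 s, 0 ≤ p i)
    (hΦ : Φ ≤ M * ∑ i ∈ Icc 1 s, p i) {n : ℕ → ℕ} (hn : ∑ j ∈ Icc 2 s, n j = M - K)
    (hE : ∑ j ∈ Icc 2 s, tailPrice s p j * n j ≤ Φ - K * ∑ i ∈ Icc 1 s, p i) :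
    IsAllocation s K M p Φ (accumulate s K n) := by
  have hfirst : accumulate s K n 1 = K := by
    rw [accumulate_of_mem (by rw [mem_Icc]; omega)]
    simp
  have hlast : accumulate s K n s = M := by
    rw [accumulate_of_mem (by rw [mem_Icc]; omega), hn]
    omega
  have hcost : 0 ≤ ∑ j ∈ Icc 2 s, tailPrice s p j * n j := sum_nonneg fun j hj =>
    mul_nonneg (tailPrice_nonneg hp (by rw [mem_Icc] at hj; omega)) (Nat.cast_nonneg _)
  refine
    { support := fun i hi => if_neg hi
      ordered := fun i hi => ?_
      lower := hfirst.ge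
      upper := hlast.le
      total := by rw [hfirst, hlast]
      budget_lower := by rw [hfirst, sum_accumulate_mul]; linarith
      budget := by rw [sum_accumulate_mul]; linarith
      budget_upper := hlast.symm ▸ hΦ }
  rw [mem_Ico] at hi
  rw [accumulate_of_mem (by rw [mem_Icc]; omega), accumulate_of_mem (by rw [mem_Icc]; omega),
    sum_Icc_succ_top (by omega)]
  omega

theorem IsAllocation.increments_mem_configurations (h : IsAllocation s K M p Φ C) (hs : 1 ≤ s) :
    increments s C ∈ configurations (fun j : Icc 2 s => tailPrice s p j) (M - K)
      (Φ - K * ∑ i ∈ Icc 1 s, p i) := by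
  have hlast := h.eq_add_sum hs le_rfl
  have hbudget := h.budget
  rw [← h.accumulate_increments, sum_accumulate_mul] at hbudget
  constructor
  · simp only [← extendByZero_coe (increments s C)]
    rw [sum_coe_sort (Icc 2 s) (extendByZero (increments s C))]
    have := h.last_eq
    omega
  · simp only [← extendByZero_coe (increments s C)]
    rw [sum_coe_sort (Icc 2 s) fun j => tailPrice s p j * (extendByZero (increments s C) j : ℝ)]
    linarith

theorem IsParameters.budget_tailPrice (h : IsParameters s K M p Φ β σ) :
    ∑ j ∈ Icc 2 s, tailPrice s p j * meanIncrement s p β σ j = Φ - K * ∑ i ∈ Icc 1 s, p i := by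
  rw [← h.budget, sum_mul_sum_Icc_two_eq le_rfl]

theorem IsParameters.budget_le (h : IsParameters s K M p Φ β σ) (hp : ∀ i ∈ Icc 1 s, 0 ≤ p i) :
    Φ ≤ M * ∑ i ∈ Icc 1 s, p i := by
  have hle : ∑ j ∈ Icc 2 s, tailPrice s p j * meanIncrement s p β σ j
      ≤ ∑ j ∈ Icc 2 s, tailPrice s p 1 * meanIncrement s p β σ j := by
    refine sum_le_sum fun j hj => mul_le_mul_of_nonneg_right ?_ (geomMean_pos (h.pos j hj)).le
    exact tailPrice_le_tailPrice hp le_rfl (by rw [mem_Icc] at hj; omega)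
  rw [← mul_sum, h.total, h.budget_tailPrice, tailPrice] at hle
  linarith

theorem IsParameters.ncard_configurations_le (h : IsParameters s K M p Φ β σ) (hs : 1 ≤ s)
    (hKM : K ≤ M) (hp : ∀ i ∈ Icc 1 s, 0 ≤ p i) :
    (configurations (fun j : Icc 2 s => tailPrice s p j) (M - K)
      (Φ - K * ∑ i ∈ Icc 1 s, p i)).ncard ≤ (allocations s K M p Φ).ncard := by
  refine Set.ncard_le_ncard_of_injOn (fun n => accumulate s K (extendByZero n)) (fun n hn => ?_)
    (Function.LeftInverse.injective increments_accumulate).injOn (allocations_finite s K M p Φ)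
  refine isAllocation_accumulate hs hKM hp (h.budget_le hp) ?_ ?_
  · simp only [← sum_coe_sort (Icc 2 s), extendByZero_coe]
    exact hn.1
  · rw [← sum_coe_sort (Icc 2 s)]
    simp only [extendByZero_coe]
    exact hn.2

/-- The indicator of the indices at most `i` among `2, …, s`: it turns the increments of an
allocation `C` into `C_i - C_1`. -/
def prefixIndicator (s i : ℕ) (j : Icc 2 s) : ℝ := if (j : ℕ) ≤ i then 1 else 0

theorem abs_prefixIndicator_le_one (i : ℕ) (j : Icc 2 s) : |prefixIndicator s i j| ≤ 1 := by
  unfold prefixIndicator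
  split_ifs <;> simp

theorem IsAllocation.sub_eq_deviation (h : IsAllocation s K M p Φ C) {i : ℕ} (hi : i ∈ Icc 1 s) :
    (C i : ℝ) - (C 1 + ∑ j ∈ Icc 2 i, meanIncrement s p β σ j)
      = deviation (fun j : Icc 2 s => β * tailPrice s p j - σ) (prefixIndicator s i)
          (increments s C) := by
  rw [mem_Icc] at hi
  have hfilter : {j ∈ Icc 2 s | j ≤ i} = Icc 2 i := by
    ext j
    simp only [mem_filter, mem_Icc]
    omega
  rw [h.first_eq, h.eq_add_sum hi.1 hi.2, deviation]
  simp only [← extendByZero_coe (increments s C), prefixIndicator]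
  rw [sum_coe_sort (Icc 2 s) fun j => (if j ≤ i then (1 : ℝ) else 0) *
    ((extendByZero (increments s C) j : ℝ) - geomMean (β * tailPrice s p j - σ))]
  simp only [ite_mul, one_mul, zero_mul]
  rw [← sum_filter, hfilter, sum_sub_distrib]
  simp only [meanIncrement, geomMean]
  push_cast
  ring

theorem ncard_sdiff_cluster_le_ncard_deviating (hs : 1 ≤ s) (δ A : ℝ) :
    (allocations s K M p Φ \ cluster s K M p Φ β σ δ A).ncard
      ≤ {n ∈ configurations (fun j : Icc 2 s => tailPrice s p j) (M - K)
          (Φ - K * ∑ i ∈ Icc 1 s, p i) | ∃ g ∈ (Icc 1 s).image (prefixIndicator s),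
            A * ((M : ℝ) - K) ^ (3 / 4 : ℝ)
              ≤ |deviation (fun j : Icc 2 s => β * tailPrice s p j - σ) g n|}.ncard := by
  refine Set.ncard_le_ncard_of_injOn (increments s) (fun C hC => ?_)
    (injOn_increments.mono Set.sdiff_subset)
    ((configurations_finite _ _ _).subset (Set.sep_subset _ _))
  obtain ⟨hC, hcluster⟩ := hC
  refine ⟨IsAllocation.increments_mem_configurations hC hs, ?_⟩
  simp only [cluster, Set.mem_ofPred_eq, hC, true_and] at hcluster
  push Not at hcluster
  obtain ⟨i, hi, -, hlt⟩ := hcluster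
  rw [IsAllocation.sub_eq_deviation hC hi] at hlt
  exact ⟨_, mem_image_of_mem _ hi, hlt.le⟩

end Allocations

noncomputable section MeanBounds

section Spread

variable {ι : Type*} [Fintype ι] {x : ι → ℝ} {D a ε N : ℝ}

theorem one_div_le_geomMean_of_spread (hx : ∀ j, 0 < x j) (hD : ∀ i j, x j ≤ D + x i)
    (htotal : ∑ j, geomMean (x j) = N) (hN : 0 < N) (hcard : Fintype.card ι ≤ a * N) (j : ι) :
    1 / (Real.exp D * (1 + a)) ≤ geomMean (x j) := by
  have hne : (univ : Finset ι).Nonempty := ⟨j, mem_univ j⟩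
  have ha : 0 < a := by
    have : (0 : ℝ) < Fintype.card ι := Nat.cast_pos.2 (Fintype.card_pos_iff.2 ⟨j⟩)
    exact pos_of_mul_pos_left (this.trans_le hcard) hN.le
  obtain ⟨i, -, hi⟩ : ∃ i ∈ univ, 1 / a ≤ geomMean (x i) := by
    refine exists_le_of_sum_le hne ?_
    rwa [htotal, sum_const, card_univ, nsmul_eq_mul, mul_one_div, div_le_iff₀' ha]
  have hexp : Real.exp (x j) ≤ Real.exp D * (1 + a) := by
    calc Real.exp (x j) ≤ Real.exp D * Real.exp (x i) := by
          rw [← Real.exp_add]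
          exact Real.exp_le_exp.2 (hD i j)
      _ ≤ Real.exp D * (1 + a) := by
          rw [exp_eq_one_add_one_div_geomMean (x i)]
          gcongr
          exact (one_div_le ha (geomMean_pos (hx i))).1 hi
  exact one_div_le_one_div_of_le (sub_pos.2 (Real.one_lt_exp_iff.2 (hx j))) (by linarith)

theorem geomMean_le_one_div_of_spread (hx : ∀ j, 0 < x j) (hD : ∀ i j, x j ≤ D + x i)
    (htotal : ∑ j, geomMean (x j) = N) (hε : 0 < ε)
    (hcard : Real.exp D * (1 + ε) ≤ 1 + Fintype.card ι / N) (j : ι) :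
    geomMean (x j) ≤ 1 / ε := by
  have hne : (univ : Finset ι).Nonempty := ⟨j, mem_univ j⟩
  have hcard0 : (0 : ℝ) < Fintype.card ι := Nat.cast_pos.2 (Fintype.card_pos_iff.2 ⟨j⟩)
  obtain ⟨i, -, hi⟩ : ∃ i ∈ univ, geomMean (x i) ≤ N / Fintype.card ι := by
    refine exists_le_of_sum_le hne (le_of_eq ?_)
    rw [htotal, sum_const, card_univ, nsmul_eq_mul, mul_div_cancel₀ _ hcard0.ne']
  have hexp : Real.exp D * (1 + ε) ≤ Real.exp D * Real.exp (x j) := by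
    calc Real.exp D * (1 + ε) ≤ 1 + Fintype.card ι / N := hcard
      _ ≤ Real.exp (x i) := by
          rw [exp_eq_one_add_one_div_geomMean, ← one_div_div]
          gcongr
          exact geomMean_pos (hx i)
      _ ≤ Real.exp D * Real.exp (x j) := by
          rw [← Real.exp_add]
          exact Real.exp_le_exp.2 (hD j i)
  have := le_of_mul_le_mul_left hexp (Real.exp_pos D)
  exact one_div_le_one_div_of_le hε (by linarith)

end Spread

/-- The regime of the concentration theorem: `s` is comparable to `N = M - K`, the prices are
nonnegative with tail sums at most `B`, `0 ≤ β ≤ β₀`, and one of the two conditions holds that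
keep the mean increments bounded. -/
structure IsConcentrationRegime (a₁ a₂ B β₀ R : ℝ) (s K M : ℕ) (p : ℕ → ℝ) (Φ β σ : ℝ) : Prop where
  lt : K < M
  mul_le : a₁ * ((M : ℝ) - K) ≤ s
  le_mul : (s : ℝ) ≤ a₂ * ((M : ℝ) - K)
  price_nonneg : ∀ i ∈ Icc 1 s, 0 ≤ p i
  tailPrice_le : ∀ i ∈ Icc 1 s, tailPrice s p i ≤ B
  parameters : IsParameters s K M p Φ β σ
  nonneg : 0 ≤ β
  le : β ≤ β₀
  alternative : Real.exp (β₀ * B) < 1 + a₁ ∨ ∀ j ∈ Icc 2 s, meanIncrement s p β σ j ≤ R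

/-- A lower bound for the mean increments in the regime `IsConcentrationRegime`. -/
def meanLowerBound (a₂ B β₀ : ℝ) : ℝ := 1 / (Real.exp (β₀ * B) * (1 + a₂))

/-- An upper bound for the mean increments in the regime `IsConcentrationRegime`, for large `N`. The
second term, which matters if `e^{β₀ B} < 1 + a₁`, is `1 / ε` for the `ε` such that
`e^{β₀ B} (1 + ε)` is halfway between `e^{β₀ B}` and `1 + a₁`. -/
def meanUpperBound (a₁ B β₀ R : ℝ) : ℝ :=
  max R (1 / (((1 + a₁) / Real.exp (β₀ * B) - 1) / 2))

variable {a₁ a₂ B β₀ R : ℝ} {s K M : ℕ} {p : ℕ → ℝ} {Φ β σ : ℝ}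

theorem IsConcentrationRegime.gap_pos
    (h : IsConcentrationRegime a₁ a₂ B β₀ R s K M p Φ β σ) : 0 < (M : ℝ) - K :=
  sub_pos.2 (Nat.cast_lt.2 h.lt)

theorem IsConcentrationRegime.length_pos
    (h : IsConcentrationRegime a₁ a₂ B β₀ R s K M p Φ β σ) (ha₁ : 0 < a₁) : 0 < s :=
  Nat.cast_pos.1 ((mul_pos ha₁ h.gap_pos).trans_le h.mul_le)

theorem IsConcentrationRegime.ratio_pos
    (h : IsConcentrationRegime a₁ a₂ B β₀ R s K M p Φ β σ) (ha₁ : 0 < a₁) : 0 < a₂ :=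
  pos_of_mul_pos_left ((Nat.cast_pos.2 (h.length_pos ha₁)).trans_le h.le_mul) h.gap_pos.le

theorem card_Icc_two_eq (hs : 1 ≤ s) : (#(Icc 2 s) : ℝ) = s - 1 := by
  rw [Nat.card_Icc, Nat.cast_sub (by omega)]
  push_cast
  ring

theorem IsConcentrationRegime.spread_le
    (h : IsConcentrationRegime a₁ a₂ B β₀ R s K M p Φ β σ) (i j : Icc 2 s) :
    β * tailPrice s p j - σ ≤ β₀ * B + (β * tailPrice s p i - σ) := by
  have hi := tailPrice_nonneg h.price_nonneg (one_le_two.trans (mem_Icc.1 i.2).1)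
  have hj := tailPrice_nonneg h.price_nonneg (one_le_two.trans (mem_Icc.1 j.2).1)
  have hjB := h.tailPrice_le j (Icc_subset_Icc_left one_le_two j.2)
  have hle : β * tailPrice s p j ≤ β₀ * B :=
    mul_le_mul h.le hjB hj (h.nonneg.trans h.le)
  have := mul_nonneg h.nonneg hi
  linarith

theorem IsConcentrationRegime.sum_geomMean
    (h : IsConcentrationRegime a₁ a₂ B β₀ R s K M p Φ β σ) :
    ∑ j : Icc 2 s, geomMean (β * tailPrice s p j - σ) = (M : ℝ) - K := by
  rw [sum_coe_sort (Icc 2 s) fun j => geomMean (β * tailPrice s p j - σ)]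
  exact h.parameters.total

theorem IsConcentrationRegime.meanLowerBound_le
    (h : IsConcentrationRegime a₁ a₂ B β₀ R s K M p Φ β σ) (ha₁ : 0 < a₁) (j : Icc 2 s) :
    meanLowerBound a₂ B β₀ ≤ geomMean (β * tailPrice s p j - σ) := by
  refine one_div_le_geomMean_of_spread (fun j : Icc 2 s => h.parameters.pos j j.2) h.spread_le
    h.sum_geomMean h.gap_pos ?_ j
  have := h.le_mul
  rw [Fintype.card_coe, card_Icc_two_eq (h.length_pos ha₁)]
  linarith

theorem IsConcentrationRegime.le_meanUpperBound
    (h : IsConcentrationRegime a₁ a₂ B β₀ R s K M p Φ β σ) (ha₁ : 0 < a₁)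
    (hN : 2 / (1 + a₁ - Real.exp (β₀ * B)) ≤ (M : ℝ) - K) (j : Icc 2 s) :
    geomMean (β * tailPrice s p j - σ) ≤ meanUpperBound a₁ B β₀ R := by
  rcases h.alternative with halt | halt
  · refine le_max_of_le_right (geomMean_le_one_div_of_spread
      (fun j : Icc 2 s => h.parameters.pos j j.2) h.spread_le h.sum_geomMean ?_ ?_ j)
    · have := (one_lt_div (Real.exp_pos (β₀ * B))).2 halt
      linarith
    · have hgap := sub_pos.2 halt
      have hinv : 1 / ((M : ℝ) - K) ≤ (1 + a₁ - Real.exp (β₀ * B)) / 2 := by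
        rw [← one_div_div 2]
        exact one_div_le_one_div_of_le (by positivity) hN
      have hratio : a₁ ≤ s / ((M : ℝ) - K) := (le_div_iff₀ h.gap_pos).2 h.mul_le
      have hmid : Real.exp (β₀ * B) * (1 + ((1 + a₁) / Real.exp (β₀ * B) - 1) / 2)
          = 1 + a₁ - (1 + a₁ - Real.exp (β₀ * B)) / 2 := by
        field_simp
        ring
      rw [Fintype.card_coe, card_Icc_two_eq (h.length_pos ha₁), hmid, sub_div (s : ℝ)]
      linarith
  · exact le_max_of_le_left (halt j j.2)

theorem IsConcentrationRegime.isBoundedEnsemble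
    (h : IsConcentrationRegime a₁ a₂ B β₀ R s K M p Φ β σ) (ha₁ : 0 < a₁)
    (hN : 2 / (1 + a₁ - Real.exp (β₀ * B)) ≤ (M : ℝ) - K) :
    IsBoundedEnsemble (fun j : Icc 2 s => tailPrice s p j) (M - K) (Φ - K * ∑ i ∈ Icc 1 s, p i)
      (meanLowerBound a₂ B β₀) (meanUpperBound a₁ B β₀ R) B β₀ β σ where
  exponent_pos j := h.parameters.pos j j.2
  total := by rw [h.sum_geomMean, Nat.cast_sub h.lt.le]
  energy := by
    rw [sum_coe_sort (Icc 2 s) fun j => tailPrice s p j * geomMean (β * tailPrice s p j - σ)]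
    exact h.parameters.budget_tailPrice
  le_mean := h.meanLowerBound_le ha₁
  mean_le := h.le_meanUpperBound ha₁ hN
  level_nonneg j := tailPrice_nonneg h.price_nonneg (one_le_two.trans (mem_Icc.1 j.2).1)
  level_le j := h.tailPrice_le j (Icc_subset_Icc_left one_le_two j.2)
  nonneg := h.nonneg
  le := h.le

end MeanBounds

noncomputable section Concentration

open Filter Topology

section Ensemble

variable {ι : Type*} [Fintype ι] {lam : ι → ℝ} {N : ℕ} {E μ R B β₀ β σ a r A : ℝ}

theorem IsBoundedEnsemble.configurations_nonempty [Nonempty ι]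
    (h : IsBoundedEnsemble lam N E μ R B β₀ β σ) : (configurations lam N E).Nonempty := by
  classical
  obtain ⟨i, hi⟩ := Finite.exists_min lam
  refine ⟨Pi.single i N, sum_pi_single' i N univ |>.trans (if_pos (mem_univ i)), ?_⟩
  calc ∑ j, lam j * (Pi.single i N : ι → ℕ) j = lam i * N := by
        rw [sum_eq_single i (fun j _ hj => by simp [hj]) (by simp), Pi.single_eq_same]
    _ = ∑ j, lam i * geomMean (β * lam j - σ) := by rw [← h.total, mul_sum]
    _ ≤ ∑ j, lam j * geomMean (β * lam j - σ) := sum_le_sum fun j _ =>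
        mul_le_mul_of_nonneg_right (hi j) (geomMean_pos (h.exponent_pos j)).le
    _ = E := h.energy

/-- The number of reserved levels per `√N` in the lower bound for the number of configurations on
at most `a N` levels: it makes the reserved mass exceed the typical fluctuations. -/
def reserveDensity (μ R a : ℝ) : ℝ := (varianceProxy R * a + 3) / μ

/-- The constant `A` for which deviations of more than `A N^{3/4}` are rare on at most `a N`
levels: it outweighs the fluctuations and the cost of filling the reserved levels. -/
def deviationRadius (μ R B β₀ a : ℝ) : ℝ :=
  varianceProxy R * a + fillingCost μ R B β₀ * (reserveDensity μ R a + 1) + 1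

theorem IsBoundedEnsemble.fillingCost_nonneg [Nonempty ι]
    (h : IsBoundedEnsemble lam N E μ R B β₀ β σ) (hμ : 0 < μ) : 0 ≤ fillingCost μ R B β₀ := by
  obtain ⟨j⟩ := ‹Nonempty ι›
  have hR : 0 < R := hμ.trans_le ((h.le_mean j).trans (h.mean_le j))
  have hB : 0 ≤ B := (h.level_nonneg j).trans (h.level_le j)
  have hβ₀ : 0 ≤ β₀ := h.nonneg.trans h.le
  unfold fillingCost
  positivity

theorem four_mul_exp_neg_three_le : 4 * Real.exp (-3) ≤ 1 / 2 := by
  have h : (2 : ℝ) ^ 3 ≤ Real.exp 1 ^ 3 :=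
    pow_le_pow_left₀ two_pos.le (by linarith [Real.add_one_le_exp 1]) 3
  rw [← Real.exp_nat_mul] at h
  rw [Real.exp_neg, ← div_eq_mul_inv, div_le_div_iff₀ (Real.exp_pos _) two_pos]
  norm_num at h
  linarith

theorem reserve_exponent_le {L k : ℝ} (hμ : 0 < μ) (hR : 0 ≤ R) (hr : 0 < r) (hk : k ≤ a * r ^ 4)
    (hL : reserveDensity μ R a * r ^ 2 ≤ L) :
    -(1 / r ^ 2 * (μ * L)) + varianceProxy R * (1 / r ^ 2) ^ 2 * k ≤ -3 := by
  have hQ := varianceProxy_nonneg hR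
  have hmass : varianceProxy R * a + 3 ≤ 1 / r ^ 2 * (μ * L) := by
    calc varianceProxy R * a + 3 = 1 / r ^ 2 * (μ * (reserveDensity μ R a * r ^ 2)) := by
          rw [reserveDensity]
          field_simp
      _ ≤ 1 / r ^ 2 * (μ * L) := by gcongr
  have hfluct : varianceProxy R * (1 / r ^ 2) ^ 2 * k ≤ varianceProxy R * a := by
    calc varianceProxy R * (1 / r ^ 2) ^ 2 * k
        ≤ varianceProxy R * (1 / r ^ 2) ^ 2 * (a * r ^ 4) := by gcongr
      _ = varianceProxy R * a := by field_simp
  linarith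

theorem deviation_exponent_le {L k : ℝ} (hΓ : 0 ≤ fillingCost μ R B β₀) (hR : 0 ≤ R) (hr : 1 ≤ r)
    (hk : k ≤ a * r ^ 4) (hL : L ≤ reserveDensity μ R a * r ^ 2 + 1)
    (hA : deviationRadius μ R B β₀ a ≤ A) :
    fillingCost μ R B β₀ * L + varianceProxy R * (1 / r) ^ 2 * k - 1 / r * (A * r ^ 3)
      ≤ -r ^ 2 := by
  have hr0 : 0 < r := one_pos.trans_le hr
  have hQ := varianceProxy_nonneg hR
  have hcost : fillingCost μ R B β₀ * L
      ≤ fillingCost μ R B β₀ * (reserveDensity μ R a + 1) * r ^ 2 := by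
    rw [mul_assoc]
    gcongr
    linarith [one_le_pow₀ hr (n := 2)]
  have hfluct : varianceProxy R * (1 / r) ^ 2 * k ≤ varianceProxy R * a * r ^ 2 := by
    calc varianceProxy R * (1 / r) ^ 2 * k ≤ varianceProxy R * (1 / r) ^ 2 * (a * r ^ 4) := by
          gcongr
      _ = varianceProxy R * a * r ^ 2 := by field_simp
  have hdev : deviationRadius μ R B β₀ a * r ^ 2 ≤ 1 / r * (A * r ^ 3) := by
    calc deviationRadius μ R B β₀ a * r ^ 2 ≤ A * r ^ 2 := by gcongr
      _ = 1 / r * (A * r ^ 3) := by field_simp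
  rw [deviationRadius] at hdev
  linarith

/-- The reserve of about `√N` levels goes with the exponential scale `u = N^{-1/2}`, the deviations
of size `N^{3/4}` with `v = N^{-1/4}`. -/
theorem IsBoundedEnsemble.ncard_deviating_le_exp [Nonempty ι]
    (h : IsBoundedEnsemble lam N E μ R B β₀ β σ) (hμ : 0 < μ) (hr : 1 ≤ r) (hrR : 4 * R ≤ r)
    (hcard : Fintype.card ι ≤ a * r ^ 4)
    (hreserve : reserveDensity μ R a * r ^ 2 + 1 < Fintype.card ι)
    (hA : deviationRadius μ R B β₀ a ≤ A) (𝒢 : Finset (ι → ℝ)) (h𝒢 : ∀ g ∈ 𝒢, ∀ j, |g j| ≤ 1) :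
    ({n ∈ configurations lam N E | ∃ g ∈ 𝒢,
        A * r ^ 3 ≤ |deviation (fun j => β * lam j - σ) g n|}.ncard : ℝ)
      ≤ 4 * #𝒢 * Real.exp (-r ^ 2) * (configurations lam N E).ncard := by
  obtain ⟨j⟩ := id ‹Nonempty ι›
  have hr0 : 0 < r := one_pos.trans_le hr
  have hR : 0 < R := hμ.trans_le ((h.le_mean j).trans (h.mean_le j))
  have ha : 0 < a := pos_of_mul_pos_left
    ((Nat.cast_pos.2 Fintype.card_pos).trans_le hcard) (by positivity)
  have hκ : 0 < reserveDensity μ R a := by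
    have := varianceProxy_nonneg hR.le
    unfold reserveDensity
    positivity
  set L := ⌈reserveDensity μ R a * r ^ 2⌉₊
  have hLlt : (L : ℝ) < reserveDensity μ R a * r ^ 2 + 1 := Nat.ceil_lt_add_one (by positivity)
  have hsmall := reserve_exponent_le hμ hR.le hr0 hcard (Nat.le_ceil _ : _ ≤ (L : ℝ))
  refine (h.ncard_deviating_le hμ (Nat.ceil_pos.2 (by positivity))
    (Nat.cast_lt.1 (hLlt.trans hreserve)) (u := 1 / r ^ 2) (v := 1 / r)
    (by positivity) ((div_le_one (by positivity)).2 (one_le_pow₀ hr)) ?_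
    (by positivity) ((div_le_one hr0).2 hr) ?_ ?_ 𝒢 h𝒢).trans ?_
  · rw [mul_one_div, div_le_one (by positivity)]
    exact hrR.trans (le_self_pow₀ hr two_ne_zero)
  · rwa [mul_one_div, div_le_one hr0]
  · exact (mul_le_mul_of_nonneg_left (Real.exp_le_exp.2 hsmall) four_pos.le).trans
      four_mul_exp_neg_three_le
  · gcongr
    exact deviation_exponent_le (h.fillingCost_nonneg hμ) hR.le hr hcard hLlt.le hA

end Ensemble

theorem eventually_mul_sq_add_lt_mul_pow_four {a : ℝ} (ha : 0 < a) (κ b : ℝ) :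
    ∀ᶠ r : ℝ in atTop, κ * r ^ 2 + b < a * r ^ 4 := by
  filter_upwards [eventually_ge_atTop 1, eventually_gt_atTop ((|κ| + |b|) / a)] with r hr hlarge
  have hr2 : 1 ≤ r ^ 2 := one_le_pow₀ hr
  rw [div_lt_iff₀ ha] at hlarge
  calc κ * r ^ 2 + b ≤ |κ| * r ^ 2 + |b| * r ^ 2 := by
        gcongr
        · exact le_abs_self κ
        · exact (le_abs_self b).trans (le_mul_of_one_le_right (abs_nonneg b) hr2)
    _ = (|κ| + |b|) * r ^ 2 := by ring
    _ < r * a * r ^ 2 := by gcongr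
    _ ≤ r ^ 2 * a * r ^ 2 := by
        gcongr
        exact le_self_pow₀ hr two_ne_zero
    _ = a * r ^ 4 := by ring

theorem eventually_mul_pow_four_mul_exp_lt_div {c : ℝ} (hc : 0 < c) (a : ℝ) (m : ℕ) :
    ∀ᶠ r : ℝ in atTop, a * r ^ 4 * Real.exp (-r ^ 2) < c / (r ^ 4) ^ m := by
  have hlim : Tendsto (fun r : ℝ => a * ((r ^ 2) ^ (2 * (m + 1)) * Real.exp (-r ^ 2))) atTop
      (𝓝 (a * 0)) :=
    ((Real.tendsto_pow_mul_exp_neg_atTop_nhds_zero (2 * (m + 1))).comp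
      (tendsto_pow_atTop two_ne_zero)).const_mul a
  rw [mul_zero] at hlim
  filter_upwards [hlim.eventually_lt_const hc, eventually_gt_atTop 0] with r hr hr0
  rw [lt_div_iff₀ (by positivity)]
  convert hr using 1
  ring

theorem tendsto_natCast_rpow_one_div_four :
    Tendsto (fun N : ℕ => (N : ℝ) ^ (1 / 4 : ℝ)) atTop atTop :=
  (tendsto_rpow_atTop (by norm_num)).comp tendsto_natCast_atTop_atTop

theorem rpow_one_div_four_pow_four {x : ℝ} (hx : 0 ≤ x) : (x ^ (1 / 4 : ℝ)) ^ 4 = x := by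
  rw [← Real.rpow_natCast, ← Real.rpow_mul hx]
  norm_num

theorem rpow_one_div_four_pow_three {x : ℝ} (hx : 0 ≤ x) :
    (x ^ (1 / 4 : ℝ)) ^ 3 = x ^ (3 / 4 : ℝ) := by
  rw [← Real.rpow_natCast, ← Real.rpow_mul hx]
  norm_num

/-- The constant `A` of the theorem. -/
def clusterRadius (a₁ a₂ B β₀ R : ℝ) : ℝ :=
  max 1 (deviationRadius (meanLowerBound a₂ B β₀) (meanUpperBound a₁ B β₀ R) B β₀ a₂)

variable {a₁ a₂ B β₀ R r : ℝ} {s K M : ℕ} {p : ℕ → ℝ} {Φ β σ : ℝ}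

theorem IsConcentrationRegime.nonempty_Icc_two
    (h : IsConcentrationRegime a₁ a₂ B β₀ R s K M p Φ β σ) : Nonempty (Icc 2 s) := by
  by_contra hempty
  rw [not_nonempty_iff] at hempty
  have hsum := h.sum_geomMean
  rw [univ_eq_empty, sum_empty] at hsum
  exact h.gap_pos.ne hsum

theorem card_image_prefixIndicator_le : #((Icc 1 s).image (prefixIndicator s)) ≤ s :=
  card_image_le.trans_eq (by simp)

theorem IsConcentrationRegime.ncard_sdiff_cluster_le
    (h : IsConcentrationRegime a₁ a₂ B β₀ R s K M p Φ β σ) (ha₁ : 0 < a₁)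
    (hN : 2 / (1 + a₁ - Real.exp (β₀ * B)) ≤ (M : ℝ) - K)
    (hrN : r = ((M : ℝ) - K) ^ (1 / 4 : ℝ)) (hr : 1 ≤ r) (hrR : 4 * meanUpperBound a₁ B β₀ R ≤ r)
    (hreserve : reserveDensity (meanLowerBound a₂ B β₀) (meanUpperBound a₁ B β₀ R) a₂ * r ^ 2 + 2
      < a₁ * r ^ 4) (δ : ℝ) :
    ((allocations s K M p Φ \ cluster s K M p Φ β σ δ (clusterRadius a₁ a₂ B β₀ R)).ncard : ℝ)
      ≤ 4 * a₂ * r ^ 4 * Real.exp (-r ^ 2) * (allocations s K M p Φ).ncard := by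
  have hs := h.length_pos ha₁
  have ha₂ := h.ratio_pos ha₁
  have hr4 : r ^ 4 = (M : ℝ) - K := hrN ▸ rpow_one_div_four_pow_four h.gap_pos.le
  have hr3 : r ^ 3 = ((M : ℝ) - K) ^ (3 / 4 : ℝ) := hrN ▸ rpow_one_div_four_pow_three h.gap_pos.le
  have hμ : 0 < meanLowerBound a₂ B β₀ := by
    unfold meanLowerBound
    positivity
  have hlower := h.mul_le
  have hupper := h.le_mul
  rw [← hr4] at hlower hupper
  have hcard : (Fintype.card (Icc 2 s) : ℝ) = s - 1 := by
    rw [Fintype.card_coe, card_Icc_two_eq hs]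
  have : Nonempty (Icc 2 s) := h.nonempty_Icc_two
  have hdev := (h.isBoundedEnsemble ha₁ hN).ncard_deviating_le_exp hμ hr hrR (a := a₂)
    (by linarith) (by linarith) (le_max_right 1 _) ((Icc 1 s).image (prefixIndicator s))
    (by
      rintro g hg j
      obtain ⟨i, -, rfl⟩ := mem_image.1 hg
      exact abs_prefixIndicator_le_one i j)
  rw [hr3] at hdev
  calc ((allocations s K M p Φ \ cluster s K M p Φ β σ δ (clusterRadius a₁ a₂ B β₀ R)).ncard : ℝ)
      ≤ _ := Nat.cast_le.2 (ncard_sdiff_cluster_le_ncard_deviating hs δ _)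
    _ ≤ _ := hdev
    _ ≤ 4 * s * Real.exp (-r ^ 2) * (allocations s K M p Φ).ncard := by
      gcongr
      · exact card_image_prefixIndicator_le
      · exact h.parameters.ncard_configurations_le hs h.lt.le h.price_nonneg
    _ ≤ 4 * (a₂ * r ^ 4) * Real.exp (-r ^ 2) * (allocations s K M p Φ).ncard := by gcongr
    _ = 4 * a₂ * r ^ 4 * Real.exp (-r ^ 2) * (allocations s K M p Φ).ncard := by ring

theorem IsConcentrationRegime.ncard_allocations_pos
    (h : IsConcentrationRegime a₁ a₂ B β₀ R s K M p Φ β σ) (ha₁ : 0 < a₁)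
    (hN : 2 / (1 + a₁ - Real.exp (β₀ * B)) ≤ (M : ℝ) - K) :
    0 < (allocations s K M p Φ).ncard := by
  have : Nonempty (Icc 2 s) := h.nonempty_Icc_two
  exact ((Set.ncard_pos (configurations_finite _ _ _)).2
    (h.isBoundedEnsemble ha₁ hN).configurations_nonempty).trans_le
      (h.parameters.ncard_configurations_le (h.length_pos ha₁) h.lt.le h.price_nonneg)

theorem exists_forall_ncard_sdiff_cluster_lt (ha₁ : 0 < a₁) (a₂ B β₀ R : ℝ) (m : ℕ) {c : ℝ}
    (hc : 0 < c) :
    ∃ N₀ : ℕ, ∀ (s K M : ℕ) (p : ℕ → ℝ) (Φ β σ : ℝ), (N₀ : ℝ) ≤ (M : ℝ) - K →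
      IsConcentrationRegime a₁ a₂ B β₀ R s K M p Φ β σ → ∀ δ : ℝ,
      ((allocations s K M p Φ \ cluster s K M p Φ β σ δ (clusterRadius a₁ a₂ B β₀ R)).ncard : ℝ)
        < c / ((M : ℝ) - K) ^ m * ((allocations s K M p Φ).ncard : ℝ) := by
  obtain ⟨N₀, hN₀⟩ := eventually_atTop.1 <|
    (tendsto_natCast_atTop_atTop.eventually_ge_atTop (2 / (1 + a₁ - Real.exp (β₀ * B)))).and <|
    tendsto_natCast_rpow_one_div_four.eventually <| (eventually_ge_atTop 1).and <|
    (eventually_ge_atTop (4 * meanUpperBound a₁ B β₀ R)).and <|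
    (eventually_mul_sq_add_lt_mul_pow_four ha₁
      (reserveDensity (meanLowerBound a₂ B β₀) (meanUpperBound a₁ B β₀ R) a₂) 2).and
    (eventually_mul_pow_four_mul_exp_lt_div hc (4 * a₂) m)
  refine ⟨N₀, fun s K M p Φ β σ hle h δ => ?_⟩
  have hcast : ((M - K : ℕ) : ℝ) = (M : ℝ) - K := Nat.cast_sub h.lt.le
  obtain ⟨hN, hr, hrR, hreserve, hexp⟩ := hN₀ (M - K) (Nat.cast_le.1 (hcast ▸ hle))
  rw [rpow_one_div_four_pow_four (Nat.cast_nonneg _)] at hexp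
  rw [hcast] at hN hr hrR hreserve hexp
  have hbad := h.ncard_sdiff_cluster_le ha₁ hN rfl hr hrR hreserve δ
  rw [rpow_one_div_four_pow_four h.gap_pos.le] at hbad
  exact hbad.trans_lt
    (mul_lt_mul_of_pos_right hexp (Nat.cast_pos.2 (h.ncard_allocations_pos ha₁ hN)))

end Concentration

section Monotonicity

variable {ι : Type*} {J : Finset ι}

theorem strictAntiOn_geomMean : StrictAntiOn geomMean (Set.Ioi 0) := fun _ hx _ _ hxy =>
  one_div_lt_one_div_of_lt (sub_pos.2 (Real.one_lt_exp_iff.2 hx))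
    (sub_lt_sub_right (Real.exp_lt_exp.2 hxy) _)

theorem continuousOn_geomMean : ContinuousOn geomMean (Set.Ioi 0) :=
  continuousOn_const.div (by fun_prop) fun _ hx => (sub_pos.2 (Real.one_lt_exp_iff.2 hx)).ne'

theorem geomMean_log_one_add {y : ℝ} (hy : 0 < y) : geomMean (Real.log (1 + 1 / y)) = y := by
  rw [geomMean, Real.exp_log (by positivity), add_sub_cancel_left, one_div_one_div]

theorem mul_geomMean_le {b h w : ℝ} (hb : 0 < b) (hh : 0 ≤ h) (hw : 0 < w) :
    h * geomMean (b * h + w) ≤ 1 / b := by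
  have hpos : 0 < b * h + w := by positivity
  have hexp := Real.add_one_le_exp (b * h + w)
  rw [geomMean, mul_one_div, div_le_div_iff₀ (by linarith) hb]
  linarith

theorem eq_of_sum_sub_mul_sub_eq_zero {f : ℝ → ℝ} {S : Set ℝ} (hf : StrictAntiOn f S)
    {x y : ι → ℝ} (hx : ∀ j ∈ J, x j ∈ S) (hy : ∀ j ∈ J, y j ∈ S)
    (h : ∑ j ∈ J, (x j - y j) * (f (x j) - f (y j)) = 0) : ∀ j ∈ J, x j = y j := by
  have hneg : ∀ j ∈ J, x j ≠ y j → (x j - y j) * (f (x j) - f (y j)) < 0 := fun j hj hne => by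
    rcases hne.lt_or_gt with hlt | hgt
    · exact mul_neg_of_neg_of_pos (sub_neg.2 hlt) (sub_pos.2 (hf (hx j hj) (hy j hj) hlt))
    · exact mul_neg_of_pos_of_neg (sub_pos.2 hgt) (sub_neg.2 (hf (hy j hj) (hx j hj) hgt))
  have hle : ∀ j ∈ J, (x j - y j) * (f (x j) - f (y j)) ≤ 0 := fun j hj => by
    rcases eq_or_ne (x j) (y j) with heq | hne
    · rw [heq, sub_self, zero_mul]
    · exact (hneg j hj hne).le
  intro j hj
  by_contra hne
  exact (hneg j hj hne).ne ((sum_eq_zero_iff_of_nonpos hle).1 h j hj)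

theorem continuousOn_of_forall_strictAntiOn_of_eq {X Y Z : Type*} [TopologicalSpace X]
    [LinearOrder Y] [TopologicalSpace Y] [OrderTopology Y] [DenselyOrdered Y]
    [LinearOrder Z] [TopologicalSpace Z] [OrderTopology Z]
    {S : Set X} {a : Y} {c : Z} {f : X → Y → Z} {W : X → Y}
    (hanti : ∀ x ∈ S, StrictAntiOn (f x) (Set.Ioi a))
    (hcont : ∀ y ∈ Set.Ioi a, ContinuousOn (fun x => f x y) S)
    (hW : ∀ x ∈ S, a < W x) (hc : ∀ x ∈ S, f x (W x) = c) : ContinuousOn W S := by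
  refine fun x hx => tendsto_order.2 ⟨fun b hb => ?_, fun b hb => ?_⟩
  · obtain ⟨v, hv, hvW⟩ := exists_between (max_lt hb (hW x hx))
    have hav : a < v := (le_max_right _ _).trans_lt hv
    have hlt : c < f x v := hc x hx ▸ hanti x hx hav (hW x hx) hvW
    filter_upwards [(hcont v hav x hx).eventually (lt_mem_nhds hlt), self_mem_nhdsWithin]
      with z hz hzS
    rw [← hc z hzS, (hanti z hzS).lt_iff_gt (hW z hzS) hav] at hz
    exact ((le_max_left _ _).trans_lt hv).trans hz
  · have hab : a < b := (hW x hx).trans hb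
    have hlt : f x b < c := hc x hx ▸ hanti x hx (hW x hx) hab hb
    filter_upwards [(hcont b hab x hx).eventually (gt_mem_nhds hlt), self_mem_nhdsWithin]
      with z hz hzS
    rwa [← hc z hzS, (hanti z hzS).lt_iff_gt hab (hW z hzS)] at hz

theorem exists_sum_geomMean_add_eq {y : ι → ℝ} (hy : ∀ j ∈ J, 0 ≤ y j) {i : ι} (hi : i ∈ J)
    (hyi : y i = 0) {N : ℝ} (hN : 0 < N) : ∃ w, 0 < w ∧ ∑ j ∈ J, geomMean (y j + w) = N := by
  have hJ : (1 : ℝ) ≤ #J := by exact_mod_cast card_pos.2 ⟨i, hi⟩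
  have hNJ : 0 < N / #J := by positivity
  set w₀ := Real.log (1 + 1 / N)
  set w₁ := Real.log (1 + 1 / (N / #J))
  have hw₀ : 0 < w₀ := Real.log_pos (by linarith [one_div_pos.2 hN])
  have hw₀₁ : w₀ ≤ w₁ := Real.log_le_log (by positivity)
    (add_le_add_right (one_div_le_one_div_of_le hNJ (div_le_self hN.le hJ)) 1)
  have hpos : ∀ j ∈ J, ∀ w ∈ Set.Icc w₀ w₁, y j + w ∈ Set.Ioi 0 := fun j hj w hw =>
    add_pos_of_nonneg_of_pos (hy j hj) (hw₀.trans_le hw.1)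
  have hcont : ContinuousOn (fun w => ∑ j ∈ J, geomMean (y j + w)) (Set.Icc w₀ w₁) :=
    continuousOn_finsetSum _ fun j hj =>
      continuousOn_geomMean.comp (by fun_prop) (hpos j hj)
  have hlower : ∑ j ∈ J, geomMean (y j + w₁) ≤ N := calc
    _ ≤ ∑ _j ∈ J, geomMean w₁ := sum_le_sum fun j hj => strictAntiOn_geomMean.antitoneOn
        (hw₀.trans_le hw₀₁) (hpos j hj w₁ ⟨hw₀₁, le_rfl⟩) (le_add_of_nonneg_left (hy j hj))
    _ = N := by
        rw [sum_const, nsmul_eq_mul, geomMean_log_one_add hNJ, mul_div_cancel₀]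
        positivity
  have hupper : N ≤ ∑ j ∈ J, geomMean (y j + w₀) := calc
    N = geomMean (y i + w₀) := by rw [hyi, zero_add, geomMean_log_one_add hN]
    _ ≤ _ := single_le_sum (f := fun j => geomMean (y j + w₀))
        (fun j hj => (geomMean_pos (hpos j hj w₀ ⟨le_rfl, hw₀₁⟩)).le) hi
  obtain ⟨w, hw, hwN⟩ := intermediate_value_Icc' hw₀₁ hcont ⟨hlower, hupper⟩
  exact ⟨w, hw₀.trans_le hw.1, hwN⟩

theorem continuousOn_of_sum_geomMean_eq {h : ι → ℝ} (hh : ∀ j ∈ J, 0 ≤ h j) (hJ : J.Nonempty)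
    {N : ℝ} {W : ℝ → ℝ} (hW : ∀ β ∈ Set.Ici (0 : ℝ), 0 < W β)
    (hN : ∀ β ∈ Set.Ici (0 : ℝ), ∑ j ∈ J, geomMean (β * h j + W β) = N) :
    ContinuousOn W (Set.Ici 0) := by
  have hpos : ∀ j ∈ J, ∀ β ∈ Set.Ici (0 : ℝ), ∀ w ∈ Set.Ioi (0 : ℝ), β * h j + w ∈ Set.Ioi 0 :=
    fun j hj β hβ w hw => add_pos_of_nonneg_of_pos (mul_nonneg hβ (hh j hj)) hw
  refine continuousOn_of_forall_strictAntiOn_of_eq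
    (f := fun β w => ∑ j ∈ J, geomMean (β * h j + w)) (fun β hβ v hv w hw hvw => ?_)
    (fun w hw => ?_) hW hN
  · exact sum_lt_sum_of_nonempty hJ fun j hj =>
      strictAntiOn_geomMean (hpos j hj β hβ v hv) (hpos j hj β hβ w hw) (by linarith)
  · exact continuousOn_finsetSum _ fun j hj =>
      continuousOn_geomMean.comp (by fun_prop) fun β hβ => hpos j hj β hβ w hw

theorem exists_sum_mul_geomMean_eq {h : ι → ℝ} (hh : ∀ j ∈ J, 0 ≤ h j) {i : ι} (hi : i ∈ J)
    (hhi : h i = 0) {N e : ℝ} (hN : 0 < N) (he : 0 < e) (heN : #J * e ≤ N * ∑ j ∈ J, h j) :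
    ∃ β w, 0 ≤ β ∧ 0 < w ∧ ∑ j ∈ J, geomMean (β * h j + w) = N ∧
      ∑ j ∈ J, h j * geomMean (β * h j + w) = e := by
  have hJ : 0 < (#J : ℝ) := by exact_mod_cast card_pos.2 ⟨i, hi⟩
  have hex : ∀ β ∈ Set.Ici (0 : ℝ), ∃ w, 0 < w ∧ ∑ j ∈ J, geomMean (β * h j + w) = N :=
    fun β hβ => exists_sum_geomMean_add_eq (fun j hj => mul_nonneg hβ (hh j hj)) hi
      (by rw [hhi, mul_zero]) hN
  choose! W hW hWN using hex
  have hcont : ContinuousOn (fun β => ∑ j ∈ J, h j * geomMean (β * h j + W β)) (Set.Ici 0) :=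
    continuousOn_finsetSum _ fun j hj => continuousOn_const.mul <| continuousOn_geomMean.comp
      ((continuousOn_id.mul continuousOn_const).add
        (continuousOn_of_sum_geomMean_eq hh ⟨i, hi⟩ hW hWN))
      fun β hβ => add_pos_of_nonneg_of_pos (mul_nonneg hβ (hh j hj)) (hW β hβ)
  have hβ₁ : 0 < #J / e := by positivity
  have hlower : ∑ j ∈ J, h j * geomMean (#J / e * h j + W (#J / e)) ≤ e := calc
    _ ≤ ∑ _j ∈ J, 1 / (#J / e) :=
        sum_le_sum fun j hj => mul_geomMean_le hβ₁ (hh j hj) (hW _ hβ₁.le)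
    _ = e := by rw [sum_const, nsmul_eq_mul]; field_simp
  have hupper : e ≤ ∑ j ∈ J, h j * geomMean (0 * h j + W 0) := by
    have hN₀ := hWN 0 Set.self_mem_Ici
    simp only [zero_mul, zero_add, sum_const, nsmul_eq_mul, ← sum_mul] at hN₀ ⊢
    refine le_of_mul_le_mul_left ?_ hJ
    calc #J * e ≤ N * ∑ j ∈ J, h j := heN
      _ = #J * ((∑ j ∈ J, h j) * geomMean (W 0)) := by rw [← hN₀]; ring
  obtain ⟨β, hβ, hβe⟩ := intermediate_value_Icc' hβ₁.le
    (hcont.mono fun γ hγ => hγ.1) ⟨hlower, hupper⟩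
  exact ⟨β, W β, hβ.1, hW β hβ.1, hWN β hβ.1, hβe⟩

end Monotonicity

section Parameters

variable {s K M : ℕ} {p : ℕ → ℝ} {Φ β σ : ℝ}

theorem IsParameters.eq_and_eq {β' σ' : ℝ} (h : IsParameters s K M p Φ β σ)
    (h' : IsParameters s K M p Φ β' σ') {i j : ℕ} (hi : i ∈ Icc 2 s) (hj : j ∈ Icc 2 s)
    (hij : tailPrice s p i ≠ tailPrice s p j) : β = β' ∧ σ = σ' := by
  have hzero : ∑ j ∈ Icc 2 s, ((β * tailPrice s p j - σ) - (β' * tailPrice s p j - σ')) *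
      (geomMean (β * tailPrice s p j - σ) - geomMean (β' * tailPrice s p j - σ')) = 0 := calc
    _ = (β - β') * (∑ j ∈ Icc 2 s, tailPrice s p j * meanIncrement s p β σ j
            - ∑ j ∈ Icc 2 s, tailPrice s p j * meanIncrement s p β' σ' j)
          - (σ - σ') * (∑ j ∈ Icc 2 s, meanIncrement s p β σ j
            - ∑ j ∈ Icc 2 s, meanIncrement s p β' σ' j) := by
        simp only [← sum_sub_distrib, mul_sum]
        refine sum_congr rfl fun j _ => ?_
        simp only [meanIncrement, geomMean]
        ring
    _ = 0 := by rw [h.budget_tailPrice, h'.budget_tailPrice, h.total, h'.total]; ring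
  have heq := eq_of_sum_sub_mul_sub_eq_zero strictAntiOn_geomMean h.pos h'.pos hzero
  have hmul : (β - β') * (tailPrice s p i - tailPrice s p j) = 0 := by
    linarith [heq i hi, heq j hj]
  have hβ : β = β' := sub_eq_zero.1 ((mul_eq_zero.1 hmul).resolve_right (sub_ne_zero.2 hij))
  subst hβ
  exact ⟨rfl, by linarith [heq i hi]⟩

theorem exists_isParameters (hs : 2 ≤ s) (hKM : K < M) (hp : ∀ i ∈ Icc 1 s, 0 ≤ p i)
    (hlower : ((M : ℝ) - K) * tailPrice s p s < Φ - K * ∑ i ∈ Icc 1 s, p i)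
    (hupper : ((s : ℝ) - 1) * (Φ - K * ∑ i ∈ Icc 1 s, p i)
        ≤ ((M : ℝ) - K) * ∑ j ∈ Icc 2 s, tailPrice s p j) :
    ∃ β σ, 0 ≤ β ∧ IsParameters s K M p Φ β σ := by
  have hN : 0 < (M : ℝ) - K := by rw [sub_pos]; exact_mod_cast hKM
  have hcard : (#(Icc 2 s) : ℝ) = s - 1 := card_Icc_two_eq (by omega)
  have hexcess : ∀ j ∈ Icc 2 s, 0 ≤ tailPrice s p j - tailPrice s p s := fun j hj =>
    sub_nonneg.2 (tailPrice_le_tailPrice hp (by rw [mem_Icc] at hj; omega) (mem_Icc.1 hj).2)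
  obtain ⟨β, w, hβ, hw, htotal, hbudget⟩ := exists_sum_mul_geomMean_eq hexcess
    (right_mem_Icc.2 hs) (sub_self _) hN (sub_pos.2 hlower)
    (by rw [sum_sub_distrib, sum_const, nsmul_eq_mul, hcard]; linarith)
  have hshift : ∀ j, β * (tailPrice s p j - tailPrice s p s) + w
      = β * tailPrice s p j - (β * tailPrice s p s - w) := fun j => by ring
  simp only [hshift] at htotal hbudget
  refine ⟨β, β * tailPrice s p s - w, hβ, fun j hj => ?_, htotal, ?_⟩
  · rw [← hshift]
    exact add_pos_of_nonneg_of_pos (mul_nonneg hβ (hexcess j hj)) hw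
  · simp only [sub_mul, sum_sub_distrib, ← mul_sum, htotal] at hbudget
    rw [sum_mul_sum_Icc_two_eq le_rfl]
    change ∑ j ∈ Icc 2 s, tailPrice s p j * geomMean _ = _
    linarith

theorem existsUnique_isParameters (hs : 2 ≤ s) (hKM : K ≤ M) (hp : ∀ i ∈ Icc 1 s, 0 ≤ p i)
    (hlower : ((M : ℝ) - K) * tailPrice s p s < Φ - K * ∑ i ∈ Icc 1 s, p i)
    (hupper : ((s : ℝ) - 1) * (Φ - K * ∑ i ∈ Icc 1 s, p i)
        ≤ ((M : ℝ) - K) * ∑ j ∈ Icc 2 s, tailPrice s p j) :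
    (∃! x : ℝ × ℝ, IsParameters s K M p Φ x.1 x.2) ∧
      ∀ β σ : ℝ, IsParameters s K M p Φ β σ → 0 ≤ β := by
  have hcard : (#(Icc 2 s) : ℝ) = s - 1 := card_Icc_two_eq (by omega)
  have hlt := mul_lt_mul_of_pos_left hlower
    (hcard ▸ Nat.cast_pos.2 (card_pos.2 ⟨s, right_mem_Icc.2 hs⟩) : (0 : ℝ) < s - 1)
  have hne : K ≠ M := by
    rintro rfl
    simp only [sub_self, zero_mul, mul_zero] at hlt hupper
    linarith
  obtain ⟨j, hj, hjs⟩ : ∃ j ∈ Icc 2 s, tailPrice s p j ≠ tailPrice s p s := by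
    by_contra! hconst
    rw [sum_congr rfl hconst, sum_const, nsmul_eq_mul, hcard] at hupper
    linarith
  obtain ⟨β, σ, hβ, h⟩ := exists_isParameters hs (lt_of_le_of_ne hKM hne) hp hlower hupper
  have huniq {β' σ' : ℝ} (h' : IsParameters s K M p Φ β' σ') : β' = β ∧ σ' = σ :=
    h'.eq_and_eq h hj (right_mem_Icc.2 hs) hjs
  exact ⟨⟨(β, σ), h, fun _ h' => Prod.ext_iff.2 (huniq h')⟩, fun _ _ h' => (huniq h').1 ▸ hβ⟩

end Parameters

theorem mainTheorem1_general :
    (∀ (s K M : ℕ) (p : ℕ → ℝ) (Φ : ℝ), 2 ≤ s → K ≤ M → (∀ i ∈ Finset.Icc 1 s, 0 ≤ p i) →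
      ((M : ℝ) - K) * tailPrice s p s < Φ - K * ∑ i ∈ Finset.Icc 1 s, p i →
      ((s : ℝ) - 1) * (Φ - K * ∑ i ∈ Finset.Icc 1 s, p i)
        ≤ ((M : ℝ) - K) * ∑ j ∈ Finset.Icc 2 s, tailPrice s p j →
      (∃! x : ℝ × ℝ, IsParameters s K M p Φ x.1 x.2) ∧
        ∀ β σ : ℝ, IsParameters s K M p Φ β σ → 0 ≤ β) ∧
    (∀ a₁ a₂ B β₀ R : ℝ, 0 < a₁ →
      ∃ A : ℝ, 0 < A ∧ ∀ (δ : ℝ) (m : ℕ) (c : ℝ), 0 < c → ∃ N₀ : ℕ,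
        ∀ (s K M : ℕ) (p : ℕ → ℝ) (Φ β σ : ℝ),
          K < M → (N₀ : ℝ) ≤ (M : ℝ) - K →
          a₁ * ((M : ℝ) - K) ≤ s → (s : ℝ) ≤ a₂ * ((M : ℝ) - K) →
          (∀ i ∈ Finset.Icc 1 s, 0 ≤ p i) →
          (∀ i ∈ Finset.Icc 1 s, tailPrice s p i ≤ B) →
          IsParameters s K M p Φ β σ → 0 ≤ β → β ≤ β₀ →
          (Real.exp (β₀ * B) < 1 + a₁ ∨
            ∀ j ∈ Finset.Icc 2 s, meanIncrement s p β σ j ≤ R) →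
          ((allocations s K M p Φ \ cluster s K M p Φ β σ δ A).ncard : ℝ)
            < c / ((M : ℝ) - K) ^ m * ((allocations s K M p Φ).ncard : ℝ)) :=
  ⟨fun _ _ _ _ _ => existsUnique_isParameters, fun a₁ a₂ B β₀ R ha₁ =>
    ⟨clusterRadius a₁ a₂ B β₀ R, one_pos.trans_le (le_max_left _ _), fun δ m _ hc =>
      (exists_forall_ncard_sdiff_cluster_lt ha₁ a₂ B β₀ R m hc).imp
        fun _ h s K M p Φ β σ hlt hN hmul_le hle_mul hp hB hparam hβ hββ₀ halt =>
          h s K M p Φ β σ hN ⟨hlt, hmul_le, hle_mul, hp, hB, hparam, hβ, hββ₀, halt⟩ δ⟩⟩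

theorem mainTheorem1 :
    -- `β` and `σ` are determined by the two conditions
    (∀ (s K M : ℕ) (p : ℕ → ℝ) (Φ : ℝ), 2 ≤ s → K ≤ M → (∀ i ∈ Finset.Icc 1 s, 0 ≤ p i) →
      ((M : ℝ) - K) * tailPrice s p s < Φ - K * ∑ i ∈ Finset.Icc 1 s, p i →
      ((s : ℝ) - 1) * (Φ - K * ∑ i ∈ Finset.Icc 1 s, p i)
        ≤ ((M : ℝ) - K) * ∑ j ∈ Finset.Icc 2 s, tailPrice s p j →
      (∃! x : ℝ × ℝ, IsParameters s K M p Φ x.1 x.2) ∧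
        ∀ β σ : ℝ, IsParameters s K M p Φ β σ → 0 ≤ β) ∧
    -- the allocations given by the formula form an overwhelming majority
    (∀ a₁ a₂ B β₀ R δ : ℝ, 0 < a₁ → 0 < δ →
      ∃ A : ℝ, 0 < A ∧ ∀ (m : ℕ) (c : ℝ), 0 < c → ∃ N₀ : ℕ,
        ∀ (s K M : ℕ) (p : ℕ → ℝ) (Φ β σ : ℝ),
          K < M → (N₀ : ℝ) ≤ (M : ℝ) - K →
          a₁ * ((M : ℝ) - K) ≤ s → (s : ℝ) ≤ a₂ * ((M : ℝ) - K) →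
          (∀ i ∈ Finset.Icc 1 s, 0 ≤ p i) →
          (∀ i ∈ Finset.Icc 1 s, tailPrice s p i ≤ B) →
          IsParameters s K M p Φ β σ → 0 ≤ β → β ≤ β₀ →
          (Real.exp (β₀ * B) < 1 + a₁ ∨
            ∀ j ∈ Finset.Icc 2 s, meanIncrement s p β σ j ≤ R) →
          ((allocations s K M p Φ \ cluster s K M p Φ β σ δ A).ncard : ℝ)
            < c / ((M : ℝ) - K) ^ m * ((allocations s K M p Φ).ncard : ℝ)) :=
  ⟨mainTheorem1_general.1, fun a₁ a₂ B β₀ R δ ha₁ _ =>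
    (mainTheorem1_general.2 a₁ a₂ B β₀ R ha₁).imp fun _ h => ⟨h.1, h.2 δ⟩⟩
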